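/- A multigraph may have parallel edges but no loops; it is cubic if every vertex has degree $3$. For a finite multigraph $H$ let $m(H,k)$ be the number of vertices of degree $k$ in $H$. **Theorem.** Every finite cubic multigraph $G$ on $n$ vertices has a spanning subgraph $H$ with $|m(H,k)-n/4|\le 2$ for $k=0,1,2,3$. More strongly, writing $a_k=m(H,k)-n/4$, the subgraph $H$ can be chosen such that $$a_0,a_3\in[-2,\tfrac12]\quad\text{and}\quad a_1,a_2\in[-\tfrac12,2].$$ Moreover, such an $H$ can be found in linear time: there are a program for a random access machine and a constant $c$ such that, for every cubic multigraph $G$ with vertices $0,\dots,n-1$ and edges $0,\dots,m-1$, given by $n$, $m$ and the two ends of each edge, the program halts after at most $c(n+1)$ unit-cost steps and has then marked exactly the edges of such a spanning subgraph $H$. (The machine has registers and arrays with indirect access; its arithmetic consists of successor, predecessor, and comparison of natural numbers.) -/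

import Mathlib

open scoped Graph

/-! ### Cubic multigraphs and degree counts

A multigraph is a Mathlib `Graph α β` (vertices in `α`, edges in `β`, parallel edges allowed)
that has no loops. -/

/-- The degree of `v` in `G`: the number of edge ends at `v` (a loop would count twice). -/
noncomputable def multiDegree {α β : Type*} (G : Graph α β) (v : α) : ℕ :=
  (G.incidenceSet v).ncard + (G.loopSet v).ncard

/-- A finite loopless multigraph in which every vertex has degree three. -/
structure IsCubicMultigraph {α β : Type*} (G : Graph α β) : Prop where
  finite : V(G).Finite
  loopless : G.Loopless
  degree_eq : ∀ v ∈ V(G), multiDegree G v = 3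

/-- `m(H, k)`: the number of vertices of degree `k` in `H`. -/
noncomputable def degreeCount {α β : Type*} (H : Graph α β) (k : ℕ) : ℕ :=
  {v | v ∈ V(H) ∧ multiDegree H v = k}.ncard

/-- `a_k(H) = m(H, k) - n / 4`, where `n` is the number of vertices of `H`. -/
noncomputable def degreeExcess {α β : Type*} (H : Graph α β) (k : ℕ) : ℚ :=
  (degreeCount H k : ℚ) - (V(H).ncard : ℚ) / 4

/-- State-0: `a_0, a_3 ∈ [-2, 1/2]` and `a_1, a_2 ∈ [-1/2, 2]`. -/
def IsStateZero {α β : Type*} (H : Graph α β) : Prop :=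
  degreeExcess H 0 ∈ Set.Icc (-2 : ℚ) (1 / 2) ∧
  degreeExcess H 1 ∈ Set.Icc (-1 / 2 : ℚ) 2 ∧
  degreeExcess H 2 ∈ Set.Icc (-1 / 2 : ℚ) 2 ∧
  degreeExcess H 3 ∈ Set.Icc (-2 : ℚ) (1 / 2)

/-! ### A random access machine with a step count

Programs are finite pieces of syntax in structured form. The memory has registers and arrays
with random (indirect) access. Arithmetic consists of successor and predecessor only, and every
node of an expression or test and every command costs one unit of time. Hence after `t` steps no
number in memory exceeds the largest number of the input or of the program by more than `t`: a
linear running time uses only numbers of `O(log n)` bits, and it is a linear running time on every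
usual RAM. -/

namespace RAM

/-- Memory: registers `reg r` and arrays `arr a` with cells `arr a i`. -/
structure Store where
  reg : ℕ → ℕ
  arr : ℕ → ℕ → ℕ

/-- Expressions over natural numbers. -/
inductive Expr where
  | lit (c : ℕ)
  | reg (r : ℕ)
  | cell (a : ℕ) (i : Expr)
  | succ (e : Expr)
  | pred (e : Expr)

/-- Value of an expression (the predecessor of `0` is `0`). -/
def Expr.eval (s : Store) : Expr → ℕ
  | .lit c => c
  | .reg r => s.reg r
  | .cell a i => s.arr a (i.eval s)
  | .succ e => e.eval s + 1
  | .pred e => e.eval s - 1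

/-- Time for evaluating an expression: its number of nodes. -/
def Expr.cost : Expr → ℕ
  | .lit _ => 1
  | .reg _ => 1
  | .cell _ i => i.cost + 1
  | .succ e => e.cost + 1
  | .pred e => e.cost + 1

/-- Tests: comparisons of expressions and their Boolean combinations. -/
inductive Test where
  | eq (e f : Expr)
  | lt (e f : Expr)
  | not (b : Test)
  | and (b c : Test)

/-- The truth value of a test. -/
def Test.Holds (s : Store) : Test → Prop
  | .eq e f => e.eval s = f.eval s
  | .lt e f => e.eval s < f.eval s
  | .not b => ¬ b.Holds s
  | .and b c => b.Holds s ∧ c.Holds s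

/-- Time for evaluating a test: its number of nodes. -/
def Test.cost : Test → ℕ
  | .eq e f => e.cost + f.cost + 1
  | .lt e f => e.cost + f.cost + 1
  | .not b => b.cost + 1
  | .and b c => b.cost + c.cost + 1

/-- Programs. -/
inductive Prog where
  | skip
  | setReg (r : ℕ) (e : Expr)
  | setCell (a : ℕ) (i e : Expr)
  | seq (p q : Prog)
  | ite (b : Test) (p q : Prog)
  | loop (b : Test) (p : Prog)

/-- Store `v` in register `r`. -/
def Store.setReg (s : Store) (r v : ℕ) : Store :=
  { s with reg := Function.update s.reg r v }

/-- Store `v` in cell `i` of array `a`. -/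
def Store.setCell (s : Store) (a i v : ℕ) : Store :=
  { s with arr := Function.update s.arr a (Function.update (s.arr a) i v) }

/-- `Exec p s t s'`: the program `p`, started in memory `s`, halts after exactly `t` time units
with memory `s'`. -/
inductive Exec : Prog → Store → ℕ → Store → Prop where
  | skip (s : Store) : Exec .skip s 1 s
  | setReg (s : Store) (r : ℕ) (e : Expr) :
      Exec (.setReg r e) s (e.cost + 1) (s.setReg r (e.eval s))
  | setCell (s : Store) (a : ℕ) (i e : Expr) :
      Exec (.setCell a i e) s (i.cost + e.cost + 1) (s.setCell a (i.eval s) (e.eval s))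
  | seq {p q : Prog} {s s₁ s₂ : Store} {t₁ t₂ : ℕ} :
      Exec p s t₁ s₁ → Exec q s₁ t₂ s₂ → Exec (.seq p q) s (t₁ + t₂) s₂
  | ite_true {b : Test} {p q : Prog} {s s' : Store} {t : ℕ} :
      b.Holds s → Exec p s t s' → Exec (.ite b p q) s (b.cost + 1 + t) s'
  | ite_false {b : Test} {p q : Prog} {s s' : Store} {t : ℕ} :
      ¬ b.Holds s → Exec q s t s' → Exec (.ite b p q) s (b.cost + 1 + t) s'
  | loop_stop {b : Test} {p : Prog} {s : Store} :
      ¬ b.Holds s → Exec (.loop b p) s (b.cost + 1) s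
  | loop_step {b : Test} {p : Prog} {s s₁ s₂ : Store} {t₁ t₂ : ℕ} :
      b.Holds s → Exec p s t₁ s₁ → Exec (.loop b p) s₁ t₂ s₂ →
      Exec (.loop b p) s (b.cost + 1 + t₁ + t₂) s₂

/-- Initial memory for a multigraph with `n` vertices and `m` edges given by a list of edges: the
registers `0` and `1` hold `n` and `m`, the cells `e < m` of the arrays `0` and `1` hold the two
ends `x e` and `y e` of the edge `e`, and everything else is `0`. -/
def inputStore (n m : ℕ) (x y : ℕ → ℕ) : Store where
  reg := fun r => if r = 0 then n else if r = 1 then m else 0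
  arr := fun a e =>
    if e < m then (if a = 0 then x e else if a = 1 then y e else 0) else 0

/-- The set of edges marked in the output array, which is array `2`. -/
def Store.output (s : Store) : Set ℕ := {e | s.arr 2 e = 1}

end RAM

/-! ### Counting ends of edges -/

section EdgeEnds

open Finset

variable {α β : Type*} [DecidableEq α]

/-! Start from all edges, where every degree is 3, and delete edges one by one as long as the caps
in `WithinBounds` hold. Only caps are maintained; the opposite inequalities come from being stuck.
The effect of a deletion on the degree counts depends only on the degrees of the two ends, the type
of the edge. So in a stuck edge set, each type that still occurs certifies that some count is at or
near its cap. Counting edge ends by degree expresses every `k * m_k` by the numbers of edges of each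
type, and `n` is even because `3 * n = 2 * m`. These linear facts imply all eight inequalities
(`degree_count_arith`).

For example, let `m₁ < ⌊n/4⌋`. Then 2-2 and 2-3 edges could be deleted, so none exist, and the
number of 1-2 edges is `2 * m₂`. Hence `m₂` is small, and if it is positive then `m₀` is at its cap;
so no 3-3 edges exist either. Thus `2 * m₂ + 3 * m₃ ≤ m₁`, which leaves fewer than `n` vertices in
total. The bound `m₂ ≤ m₀ + 2` excludes a stall with `m₁`, `m₂` at their caps and `m₀` still small.

For linear time, each of the nine types has a stack containing all present edges of that type, and
possibly stale entries. A deletion changes types only at the two ends of the edge, so boundedly many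
pushes repair the stacks, and the potential `stackSize + 55 * #H` drops in every pass
(`Represents.process_spec`). When the loop stops, every removable type has an empty stack, so the
edge set is stuck. -/

/-- The number of ends at `v` of edges in `H`, where `e` has the ends `x e` and `y e`. -/
def endDegree (x y : β → α) (H : Finset β) (v : α) : ℕ :=
  #{e ∈ H | x e = v} + #{e ∈ H | y e = v}

/-- The number of vertices in `V` with `k` ends of edges in `H`. -/
def endDegreeCount (x y : β → α) (V : Finset α) (H : Finset β) (k : ℕ) : ℕ :=
  #{v ∈ V | endDegree x y H v = k}

/-- The edges in `H` with an end of degree `i` and an end of degree `j`, in this order. -/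
def edgesOfType (x y : β → α) (H : Finset β) (i j : ℕ) : Finset β :=
  {e ∈ H | endDegree x y H (x e) = i ∧ endDegree x y H (y e) = j}

/-- The upper bounds on the numbers of vertices of degree `0`, `1`, `2` that are maintained while
edges are removed. -/
def WithinBounds (n m₀ m₁ m₂ : ℕ) : Prop :=
  m₀ ≤ (n + 2) / 4 ∧ m₁ ≤ n / 4 + 1 ∧ m₂ ≤ (n + 2) / 4 + 1 ∧ m₂ ≤ m₀ + 2

/-- `WithinBounds` for the degree counts of an edge set. -/
def EdgesWithinBounds (x y : β → α) (V : Finset α) (H : Finset β) : Prop :=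
  WithinBounds #V (endDegreeCount x y V H 0) (endDegreeCount x y V H 1) (endDegreeCount x y V H 2)

variable {x y : β → α} {V : Finset α} {H : Finset β}

theorem one_le_endDegree_left {e : β} (he : e ∈ H) : 1 ≤ endDegree x y H (x e) := by
  have : 0 < #{e' ∈ H | x e' = x e} := card_pos.2 ⟨e, by simp [he]⟩
  unfold endDegree; omega

theorem one_le_endDegree_right {e : β} (he : e ∈ H) : 1 ≤ endDegree x y H (y e) := by
  have : 0 < #{e' ∈ H | y e' = y e} := card_pos.2 ⟨e, by simp [he]⟩
  unfold endDegree; omega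

theorem endDegree_mono {H' : Finset β} (h : H ⊆ H') (v : α) :
    endDegree x y H v ≤ endDegree x y H' v :=
  Nat.add_le_add (card_le_card (filter_subset_filter _ h)) (card_le_card (filter_subset_filter _ h))

/-- Double counting of the edge ends that lie at vertices of degree `k`. -/
theorem mul_endDegreeCount (hV : ∀ e ∈ H, x e ∈ V ∧ y e ∈ V) (k : ℕ) :
    k * endDegreeCount x y V H k =
      #{e ∈ H | endDegree x y H (x e) = k} + #{e ∈ H | endDegree x y H (y e) = k} := by
  have key : ∀ z : β → α, (∀ e ∈ H, z e ∈ V) →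
      #{e ∈ H | endDegree x y H (z e) = k} =
        ∑ v ∈ V with endDegree x y H v = k, #{e ∈ H | z e = v} := by
    intro z hz
    rw [card_eq_sum_card_fiberwise (f := z) (t := {v ∈ V | endDegree x y H v = k})]
    · refine sum_congr rfl fun v hv => ?_
      rw [filter_filter]
      congr 1
      ext e
      simp only [mem_filter] at hv ⊢
      constructor
      · rintro ⟨h1, -, h2⟩; exact ⟨h1, h2⟩
      · rintro ⟨h1, rfl⟩; exact ⟨h1, hv.2, rfl⟩
    · intro e he
      simp only [coe_filter, Set.mem_ofPred_eq] at he ⊢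
      exact ⟨hz e he.1, he.2⟩
  rw [key x fun e he => (hV e he).1, key y fun e he => (hV e he).2, ← sum_add_distrib,
    endDegreeCount, mul_comm, ← smul_eq_mul, ← sum_const]
  exact sum_congr rfl fun v hv => (mem_filter.1 hv).2.symm

/-- The ends of degree `k` are sorted by the degree at the other end of their edge. An edge of type
`(k, k)` appears in both brackets, once for each end. -/
theorem mul_endDegreeCount_eq_edgesOfType (hV : ∀ e ∈ H, x e ∈ V ∧ y e ∈ V)
    (h3 : ∀ v ∈ V, endDegree x y H v ≤ 3) (k : ℕ) :
    k * endDegreeCount x y V H k =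
      (#(edgesOfType x y H k 1) + #(edgesOfType x y H k 2) + #(edgesOfType x y H k 3)) +
      (#(edgesOfType x y H 1 k) + #(edgesOfType x y H 2 k) + #(edgesOfType x y H 3 k)) := by
  have split : ∀ (z w : β → α), (∀ e ∈ H, 1 ≤ endDegree x y H (w e) ∧ endDegree x y H (w e) ≤ 3) →
      #{e ∈ H | endDegree x y H (z e) = k} =
        #{e ∈ H | endDegree x y H (z e) = k ∧ endDegree x y H (w e) = 1} +
        #{e ∈ H | endDegree x y H (z e) = k ∧ endDegree x y H (w e) = 2} +
        #{e ∈ H | endDegree x y H (z e) = k ∧ endDegree x y H (w e) = 3} := by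
    intro z w hw
    simp only [card_filter, ← sum_add_distrib]
    refine sum_congr rfl fun e he => ?_
    have := hw e he
    split_ifs <;> omega
  rw [mul_endDegreeCount hV,
    split x y fun e he => ⟨one_le_endDegree_right he, h3 _ (hV e he).2⟩,
    split y x fun e he => ⟨one_le_endDegree_left he, h3 _ (hV e he).1⟩]
  simp only [edgesOfType, and_comm]

theorem sum_endDegreeCount (h3 : ∀ v ∈ V, endDegree x y H v ≤ 3) :
    endDegreeCount x y V H 0 + endDegreeCount x y V H 1 + endDegreeCount x y V H 2 +
      endDegreeCount x y V H 3 = #V := by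
  simp only [endDegreeCount, card_filter, ← sum_add_distrib, card_eq_sum_ones V]
  refine sum_congr rfl fun v hv => ?_
  have := h3 v hv
  split_ifs <;> omega

theorem three_mul_card_of_regular (hV : ∀ e ∈ H, x e ∈ V ∧ y e ∈ V)
    (h3 : ∀ v ∈ V, endDegree x y H v = 3) : 3 * #V = 2 * #H := by
  have h := mul_endDegreeCount hV 3
  rw [endDegreeCount, filter_true_of_mem h3, filter_true_of_mem fun e he => h3 _ (hV e he).1,
    filter_true_of_mem fun e he => h3 _ (hV e he).2] at h
  omega

theorem edgesWithinBounds_of_regular (h3 : ∀ v ∈ V, endDegree x y H v = 3) :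
    EdgesWithinBounds x y V H := by
  have hz : ∀ k, k ≠ 3 → endDegreeCount x y V H k = 0 := by
    intro k hk
    rw [endDegreeCount, card_eq_zero, filter_eq_empty_iff]
    intro v hv h
    exact hk (h.symm.trans (h3 v hv))
  simp [EdgesWithinBounds, WithinBounds, hz]

/-! ### Deleting one edge, and edge sets from which none can be deleted -/

variable [DecidableEq β]

theorem endDegree_erase {e : β} (he : e ∈ H) (v : α) :
    endDegree x y (H.erase e) v + ((if x e = v then 1 else 0) + (if y e = v then 1 else 0)) =
      endDegree x y H v := by
  have key : ∀ z : β → α,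
      #{e' ∈ H.erase e | z e' = v} + (if z e = v then 1 else 0) = #{e' ∈ H | z e' = v} := by
    intro z
    rw [filter_erase]
    split_ifs with h
    · exact card_erase_add_one (by simp [he, h])
    · rw [erase_eq_of_notMem (by simp [h]), add_zero]
  have h1 := key x
  have h2 := key y
  unfold endDegree
  omega

/-- As the two ends differ, each of them drops by exactly one degree: it leaves class `k` or enters
it from class `k + 1`. The additive form avoids truncated subtraction. -/
theorem endDegreeCount_erase {e : β} (he : e ∈ H) (hx : x e ∈ V) (hy : y e ∈ V)
    (hne : x e ≠ y e) (k : ℕ) :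
    endDegreeCount x y V (H.erase e) k +
        ((if endDegree x y H (x e) = k then 1 else 0) +
          (if endDegree x y H (y e) = k then 1 else 0)) =
      endDegreeCount x y V H k +
        ((if endDegree x y H (x e) = k + 1 then 1 else 0) +
          (if endDegree x y H (y e) = k + 1 then 1 else 0)) := by
  -- Writing the correction terms as sums over `V` lets the identity be checked vertex by vertex.
  have pt : ∀ (z : α) (a : ℕ), z ∈ V → a = ∑ v ∈ V, if z = v then a else 0 := by
    intro z a hz
    rw [sum_ite_eq, if_pos hz]
  rw [pt (x e) (if endDegree x y H (x e) = k then 1 else 0) hx,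
    pt (y e) (if endDegree x y H (y e) = k then 1 else 0) hy,
    pt (x e) (if endDegree x y H (x e) = k + 1 then 1 else 0) hx,
    pt (y e) (if endDegree x y H (y e) = k + 1 then 1 else 0) hy]
  simp only [endDegreeCount, card_filter, ← sum_add_distrib]
  refine sum_congr rfl fun v _ => ?_
  have h := endDegree_erase (x := x) (y := y) he v
  by_cases h1 : x e = v
  · have h2 : y e ≠ v := fun h2 => hne (h1.trans h2.symm)
    have h4 := one_le_endDegree_left (x := x) (y := y) he
    simp only [h1, h2, if_true, if_false] at h h4 ⊢
    split_ifs <;> omega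
  · by_cases h2 : y e = v
    · have h4 := one_le_endDegree_right (x := x) (y := y) he
      simp only [h1, h2, if_true, if_false] at h h4 ⊢
      split_ifs <;> omega
    · simp only [h1, h2, if_false] at h ⊢
      rw [show endDegree x y (H.erase e) v = endDegree x y H v by omega]

/-- Here `eᵢⱼ` counts unordered types, and `sᵢⱼ` lists just those bounds that deleting such an edge
can break; only a 3-3 edge threatens `m₂ ≤ m₀ + 2`. The degree sum makes `m₁ + m₃` even, which is
needed for the lower bound on `m₃` when `n % 4 = 2`. -/
theorem degree_count_arith {n m₀ m₁ m₂ m₃ e₁₁ e₁₂ e₁₃ e₂₂ e₂₃ e₃₃ : ℕ}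
    (hn : m₀ + m₁ + m₂ + m₃ = n) (hev : n % 2 = 0) (hw : WithinBounds n m₀ m₁ m₂)
    (h1 : m₁ = 2 * e₁₁ + e₁₂ + e₁₃) (h2 : 2 * m₂ = 2 * e₂₂ + e₁₂ + e₂₃)
    (h3 : 3 * m₃ = 2 * e₃₃ + e₁₃ + e₂₃)
    (s11 : e₁₁ = 0 ∨ (n + 2) / 4 < m₀ + 2)
    (s12 : e₁₂ = 0 ∨ (n + 2) / 4 < m₀ + 1)
    (s13 : e₁₃ = 0 ∨ (n + 2) / 4 < m₀ + 1 ∨ (n + 2) / 4 + 1 < m₂ + 1)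
    (s22 : e₂₂ = 0 ∨ n / 4 + 1 < m₁ + 2)
    (s23 : e₂₃ = 0 ∨ n / 4 + 1 < m₁ + 1)
    (s33 : e₃₃ = 0 ∨ (n + 2) / 4 + 1 < m₂ + 2 ∨ m₀ + 2 < m₂ + 2) :
    (n ≤ 4 * m₀ + 8 ∧ 4 * m₀ ≤ n + 2) ∧ (n ≤ 4 * m₁ + 2 ∧ 4 * m₁ ≤ n + 8) ∧
      (n ≤ 4 * m₂ + 2 ∧ 4 * m₂ ≤ n + 8) ∧ (n ≤ 4 * m₃ + 8 ∧ 4 * m₃ ≤ n + 2) := by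
  obtain ⟨w0, w1, w2, w3⟩ := hw
  omega

/-- If no edge can be removed within the bounds, all four degrees are almost equally frequent. -/
theorem endDegreeCount_bounds_of_no_removal (hV : ∀ e ∈ H, x e ∈ V ∧ y e ∈ V)
    (hne : ∀ e ∈ H, x e ≠ y e) (h3 : ∀ v ∈ V, endDegree x y H v ≤ 3) (hev : #V % 2 = 0)
    (hw : EdgesWithinBounds x y V H) (hmin : ∀ e ∈ H, ¬ EdgesWithinBounds x y V (H.erase e)) :
    (#V ≤ 4 * endDegreeCount x y V H 0 + 8 ∧ 4 * endDegreeCount x y V H 0 ≤ #V + 2) ∧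
      (#V ≤ 4 * endDegreeCount x y V H 1 + 2 ∧ 4 * endDegreeCount x y V H 1 ≤ #V + 8) ∧
      (#V ≤ 4 * endDegreeCount x y V H 2 + 2 ∧ 4 * endDegreeCount x y V H 2 ≤ #V + 8) ∧
      (#V ≤ 4 * endDegreeCount x y V H 3 + 8 ∧ 4 * endDegreeCount x y V H 3 ≤ #V + 2) := by
  -- The counts after the deletion are unknowns tied to the old ones by additive equations, so that
  -- `omega` can eliminate them for each concrete type.
  have stuck : ∀ i j, edgesOfType x y H i j = ∅ ∨
      ∃ m₀ m₁ m₂, ¬ WithinBounds #V m₀ m₁ m₂ ∧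
        m₀ + ((if i = 0 then 1 else 0) + (if j = 0 then 1 else 0)) =
          endDegreeCount x y V H 0 + ((if i = 1 then 1 else 0) + (if j = 1 then 1 else 0)) ∧
        m₁ + ((if i = 1 then 1 else 0) + (if j = 1 then 1 else 0)) =
          endDegreeCount x y V H 1 + ((if i = 2 then 1 else 0) + (if j = 2 then 1 else 0)) ∧
        m₂ + ((if i = 2 then 1 else 0) + (if j = 2 then 1 else 0)) =
          endDegreeCount x y V H 2 + ((if i = 3 then 1 else 0) + (if j = 3 then 1 else 0)) := by
    intro i j
    refine (edgesOfType x y H i j).eq_empty_or_nonempty.imp_right ?_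
    rintro ⟨e, he⟩
    obtain ⟨heH, rfl, rfl⟩ := mem_filter.1 he
    have hc := endDegreeCount_erase heH (hV e heH).1 (hV e heH).2 (hne e heH)
    exact ⟨_, _, _, hmin e heH, hc 0, hc 1, hc 2⟩
  have dc := mul_endDegreeCount_eq_edgesOfType hV h3
  have hsum := sum_endDegreeCount h3
  have d1 := dc 1
  have d2 := dc 2
  have d3 := dc 3
  have nonpos : ∀ i j, edgesOfType x y H i j = ∅ → #(edgesOfType x y H i j) = 0 :=
    fun i j h => card_eq_zero.2 h
  have hw' := hw
  unfold EdgesWithinBounds WithinBounds at hw'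
  refine degree_count_arith (e₁₁ := #(edgesOfType x y H 1 1))
    (e₁₂ := #(edgesOfType x y H 1 2) + #(edgesOfType x y H 2 1))
    (e₁₃ := #(edgesOfType x y H 1 3) + #(edgesOfType x y H 3 1))
    (e₂₂ := #(edgesOfType x y H 2 2))
    (e₂₃ := #(edgesOfType x y H 2 3) + #(edgesOfType x y H 3 2))
    (e₃₃ := #(edgesOfType x y H 3 3)) hsum hev hw
    (by omega) (by omega) (by omega) ?_ ?_ ?_ ?_ ?_ ?_
  · obtain h | ⟨m₀, m₁, m₂, hb, h0, h1, h2⟩ := stuck 1 1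
    · exact .inl (nonpos _ _ h)
    · simp only [WithinBounds] at hb; simp at h0 h1 h2; omega
  · obtain h | ⟨m₀, m₁, m₂, hb, h0, h1, h2⟩ := stuck 1 2
    · obtain h' | ⟨m₀, m₁, m₂, hb, h0, h1, h2⟩ := stuck 2 1
      · left; rw [nonpos _ _ h, nonpos _ _ h']
      · simp only [WithinBounds] at hb; simp at h0 h1 h2; omega
    · simp only [WithinBounds] at hb; simp at h0 h1 h2; omega
  · obtain h | ⟨m₀, m₁, m₂, hb, h0, h1, h2⟩ := stuck 1 3
    · obtain h' | ⟨m₀, m₁, m₂, hb, h0, h1, h2⟩ := stuck 3 1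
      · left; rw [nonpos _ _ h, nonpos _ _ h']
      · simp only [WithinBounds] at hb; simp at h0 h1 h2; omega
    · simp only [WithinBounds] at hb; simp at h0 h1 h2; omega
  · obtain h | ⟨m₀, m₁, m₂, hb, h0, h1, h2⟩ := stuck 2 2
    · exact .inl (nonpos _ _ h)
    · simp only [WithinBounds] at hb; simp at h0 h1 h2; omega
  · obtain h | ⟨m₀, m₁, m₂, hb, h0, h1, h2⟩ := stuck 2 3
    · obtain h' | ⟨m₀, m₁, m₂, hb, h0, h1, h2⟩ := stuck 3 2
      · left; rw [nonpos _ _ h, nonpos _ _ h']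
      · simp only [WithinBounds] at hb; simp at h0 h1 h2; omega
    · simp only [WithinBounds] at hb; simp at h0 h1 h2; omega
  · obtain h | ⟨m₀, m₁, m₂, hb, h0, h1, h2⟩ := stuck 3 3
    · exact .inl (nonpos _ _ h)
    · simp only [WithinBounds] at hb; simp at h0 h1 h2; omega

end EdgeEnds

/-! ### Spanning subgraphs of cubic multigraphs as edge sets -/

section Spanning

open Finset

variable {α β : Type*} {G : Graph α β} {x y : β → α} {V : Finset α}
  {E H : Finset β} {F : Set β}

theorem ends_mem (hV : V(G) = ↑V) (hl : ∀ e ∈ E, G.IsLink e (x e) (y e)) {e : β} (he : e ∈ E) :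
    x e ∈ V ∧ y e ∈ V := by
  rw [← mem_coe, ← mem_coe, ← hV]
  exact ⟨(hl e he).left_mem, (hl e he).right_mem⟩

variable [DecidableEq α]

/-- Without loops an incident edge has exactly one of its chosen ends at `v`, so the incidence set
is a disjoint union. `F` may contain non-edges, since restriction only sees `E(G) ∩ F`. -/
theorem multiDegree_restrict (hG : G.Loopless) (hE : E(G) = ↑E)
    (hl : ∀ e ∈ E, G.IsLink e (x e) (y e)) (hF : E(G) ∩ F = ↑H) (v : α) :
    multiDegree (G.restrict F) v = endDegree x y H v := by
  have hH : ∀ e, e ∈ H ↔ e ∈ E ∧ e ∈ F := by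
    intro e
    rw [← mem_coe, ← hF, hE]; rfl
  have hloop : (G.restrict F).loopSet v = ∅ := by
    ext e; simp
  classical
  have hinc : (G.restrict F).incidenceSet v =
      ↑({e ∈ H | x e = v} ∪ {e ∈ H | y e = v} : Finset β) := by
    ext e
    simp only [Graph.mem_incidenceSet, Graph.restrict_inc, mem_coe, mem_union, mem_filter, hH]
    constructor
    · rintro ⟨hi, he⟩
      have heE : e ∈ E := by rw [← mem_coe, ← hE]; exact hi.edge_mem
      obtain h | h := hi.eq_or_eq_of_isLink (hl e heE)
      · exact .inl ⟨⟨heE, he⟩, h.symm⟩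
      · exact .inr ⟨⟨heE, he⟩, h.symm⟩
    · rintro (⟨⟨heE, he⟩, rfl⟩ | ⟨⟨heE, he⟩, rfl⟩)
      · exact ⟨(hl e heE).inc_left, he⟩
      · exact ⟨(hl e heE).inc_right, he⟩
  have hdisj : Disjoint {e ∈ H | x e = v} {e ∈ H | y e = v} := by
    rw [disjoint_filter]
    intro e he h1 h2
    exact (hl e ((hH e).1 he).1).ne (h1.trans h2.symm)
  rw [multiDegree, hloop, Set.ncard_empty, add_zero, endDegree, ← card_union_of_disjoint hdisj,
    hinc, Set.ncard_coe_finset]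

theorem degreeCount_restrict (hG : G.Loopless) (hV : V(G) = ↑V) (hE : E(G) = ↑E)
    (hl : ∀ e ∈ E, G.IsLink e (x e) (y e)) (hF : E(G) ∩ F = ↑H) (k : ℕ) :
    degreeCount (G.restrict F) k = endDegreeCount x y V H k := by
  rw [degreeCount, endDegreeCount, ← Set.ncard_coe_finset]
  congr 1
  ext v
  simp [multiDegree_restrict hG hE hl hF, hV]

theorem endDegree_eq_three (hG : IsCubicMultigraph G) (hV : V(G) = ↑V) (hE : E(G) = ↑E)
    (hl : ∀ e ∈ E, G.IsLink e (x e) (y e)) {v : α} (hv : v ∈ V) : endDegree x y E v = 3 := by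
  rw [← multiDegree_restrict hG.loopless hE hl (F := E(G)) (by rw [Set.inter_self, hE]),
    Graph.restrict_self]
  exact hG.degree_eq v (by rw [hV]; exact hv)

/-- A spanning subgraph within the bounds from which no edge can be removed within the bounds is in
State-0. -/
theorem isStateZero_of_no_removal [DecidableEq β] (hG : IsCubicMultigraph G) (hV : V(G) = ↑V)
    (hE : E(G) = ↑E) (hl : ∀ e ∈ E, G.IsLink e (x e) (y e)) (hF : E(G) ∩ F = ↑H)
    (hw : EdgesWithinBounds x y V H) (hmin : ∀ e ∈ H, ¬ EdgesWithinBounds x y V (H.erase e)) :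
    Graph.IsSpanningSubgraph (G.restrict F) G ∧
      (∀ k : ℕ, k ≤ 3 → |(degreeCount (G.restrict F) k : ℚ) - (#V : ℚ) / 4| ≤ 2) ∧
      IsStateZero (G.restrict F) := by
  have hHE : H ⊆ E := by
    rw [← coe_subset, ← hF, ← hE]; exact Set.inter_subset_left
  have hloop := hG.loopless
  have h3 : ∀ v ∈ V, endDegree x y E v = 3 := fun v hv => endDegree_eq_three hG hV hE hl hv
  have hev : #V % 2 = 0 := by
    have := three_mul_card_of_regular (fun e he => ends_mem hV hl he) h3
    omega
  obtain ⟨⟨a0, b0⟩, ⟨a1, b1⟩, ⟨a2, b2⟩, ⟨a3, b3⟩⟩ :=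
    endDegreeCount_bounds_of_no_removal (fun e he => ends_mem hV hl (hHE he))
      (fun e he => (hl e (hHE he)).ne)
      (fun v hv => (endDegree_mono hHE v).trans (h3 v hv).le) hev hw hmin
  have hdc := degreeCount_restrict hloop hV hE hl hF
  rw [← hdc] at a0 b0 a1 b1 a2 b2 a3 b3
  have hn : (V(G.restrict F)).ncard = #V := by
    rw [Graph.vertexSet_restrict, hV, Set.ncard_coe_finset]
  have a0' : (#V : ℚ) ≤ 4 * degreeCount (G.restrict F) 0 + 8 := by exact_mod_cast a0
  have b0' : 4 * (degreeCount (G.restrict F) 0 : ℚ) ≤ #V + 2 := by exact_mod_cast b0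
  have a1' : (#V : ℚ) ≤ 4 * degreeCount (G.restrict F) 1 + 2 := by exact_mod_cast a1
  have b1' : 4 * (degreeCount (G.restrict F) 1 : ℚ) ≤ #V + 8 := by exact_mod_cast b1
  have a2' : (#V : ℚ) ≤ 4 * degreeCount (G.restrict F) 2 + 2 := by exact_mod_cast a2
  have b2' : 4 * (degreeCount (G.restrict F) 2 : ℚ) ≤ #V + 8 := by exact_mod_cast b2
  have a3' : (#V : ℚ) ≤ 4 * degreeCount (G.restrict F) 3 + 8 := by exact_mod_cast a3
  have b3' : 4 * (degreeCount (G.restrict F) 3 : ℚ) ≤ #V + 2 := by exact_mod_cast b3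
  refine ⟨⟨Graph.restrict_le, rfl⟩, ?_, ?_⟩
  · intro k hk
    rw [abs_le]
    interval_cases k <;> constructor <;> linarith
  · simp only [IsStateZero, degreeExcess, hn, Set.mem_Icc]
    refine ⟨⟨?_, ?_⟩, ⟨?_, ?_⟩, ⟨?_, ?_⟩, ?_, ?_⟩ <;> linarith

end Spanning

/-! ### Existence of the subgraph -/

theorem IsCubicMultigraph.finite_edgeSet {α β : Type*} {G : Graph α β} (hG : IsCubicMultigraph G) :
    E(G).Finite := by
  have hloop := hG.loopless
  refine (hG.finite.biUnion (t := fun v => G.incidenceSet v) fun v hv => ?_).subset ?_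
  -- An infinite incidence set would have `ncard` equal to 0, not 3.
  · refine Set.finite_of_ncard_ne_zero ?_
    have h := hG.degree_eq v hv
    have h0 : G.loopSet v = ∅ := by ext e; simp
    rw [multiDegree, h0, Set.ncard_empty] at h
    omega
  · intro e he
    obtain ⟨u, v, h⟩ := G.exists_isLink_of_mem_edgeSet he
    exact Set.mem_biUnion h.left_mem h.inc_left

theorem IsCubicMultigraph.exists_isStateZero {α β : Type*} {G : Graph α β}
    (hG : IsCubicMultigraph G) :
    ∃ H : Graph α β, Graph.IsSpanningSubgraph H G ∧
      (∀ k : ℕ, k ≤ 3 → |(degreeCount H k : ℚ) - (V(G).ncard : ℚ) / 4| ≤ 2) ∧ IsStateZero H := by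
  classical
  obtain ⟨V, hV⟩ := hG.finite.exists_finset_coe
  obtain ⟨E, hE⟩ := hG.finite_edgeSet.exists_finset_coe
  -- Choosing total functions `x`, `y` requires an element of `α` as the value at non-edges.
  obtain hα | hα := isEmpty_or_nonempty α
  · have h0 : V(G) = ∅ := Set.eq_empty_of_isEmpty _
    have hc : ∀ k, degreeCount G k = 0 := by
      intro k
      simp [degreeCount, h0]
    refine ⟨G, Graph.IsSpanningSubgraph.rfl, ?_, ?_⟩
    · simp [hc, h0]
    · norm_num [IsStateZero, degreeExcess, hc, h0]
  have hl : ∀ e, ∃ u v, e ∈ E → G.IsLink e u v := by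
    intro e
    by_cases he : e ∈ E
    · obtain ⟨u, v, h⟩ := G.exists_isLink_of_mem_edgeSet (e := e) (by rw [← hE]; exact he)
      exact ⟨u, v, fun _ => h⟩
    · exact ⟨hα.some, hα.some, fun h => absurd h he⟩
  choose x y hl using hl
  have hw : EdgesWithinBounds x y V E :=
    edgesWithinBounds_of_regular fun v hv => endDegree_eq_three hG hV.symm hE.symm hl hv
  -- An edge set of least size within the bounds is stuck; for mere existence this replaces the
  -- deletion process.
  obtain ⟨H, hH, hmin⟩ := Finset.exists_min_image
    ({H ∈ E.powerset | EdgesWithinBounds x y V H}) Finset.card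
    ⟨E, Finset.mem_filter.2 ⟨Finset.mem_powerset_self E, hw⟩⟩
  simp only [Finset.mem_filter, Finset.mem_powerset] at hH hmin
  have hn : V(G).ncard = V.card := by rw [← hV, Set.ncard_coe_finset]
  refine ⟨G.restrict ↑H, ?_⟩
  rw [hn]
  refine isStateZero_of_no_removal hG hV.symm hE.symm hl (H := H) ?_ hH.2 ?_
  · rw [← hE, Set.inter_eq_right]
    exact_mod_cast hH.1
  · intro e he hw
    have h1 := hmin _ ⟨(Finset.erase_subset _ _).trans hH.1, hw⟩
    have h2 := Finset.card_erase_lt_of_mem he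
    omega

/-! ### Loop-free programs and loops -/

namespace RAM

/-- Programs without loops. -/
def Prog.LoopFree : Prog → Prop
  | .seq p q => p.LoopFree ∧ q.LoopFree
  | .ite _ p q => p.LoopFree ∧ q.LoopFree
  | .loop _ _ => False
  | _ => True

open Classical in
/-- The memory after running a loop-free program. -/
noncomputable def Prog.run : Prog → Store → Store
  | .skip, s => s
  | .setReg r e, s => s.setReg r (e.eval s)
  | .setCell a i e, s => s.setCell a (i.eval s) (e.eval s)
  | .seq p q, s => q.run (p.run s)
  | .ite b p q, s => if b.Holds s then p.run s else q.run s
  | .loop _ _, s => s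

/-- An upper bound for the running time of a loop-free program. -/
def Prog.maxCost : Prog → ℕ
  | .skip => 1
  | .setReg _ e => e.cost + 1
  | .setCell _ i e => i.cost + e.cost + 1
  | .seq p q => p.maxCost + q.maxCost
  | .ite b p q => b.cost + 1 + (p.maxCost + q.maxCost)
  | .loop _ _ => 0

theorem Prog.exec_run {p : Prog} (hp : p.LoopFree) (s : Store) :
    ∃ t ≤ p.maxCost, Exec p s t (p.run s) := by
  induction p generalizing s with
  | skip => exact ⟨_, le_rfl, .skip s⟩
  | setReg r e => exact ⟨_, le_rfl, .setReg s r e⟩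
  | setCell a i e => exact ⟨_, le_rfl, .setCell s a i e⟩
  | seq p q ihp ihq =>
    obtain ⟨t₁, h₁, e₁⟩ := ihp hp.1 s
    obtain ⟨t₂, h₂, e₂⟩ := ihq hp.2 (p.run s)
    exact ⟨t₁ + t₂, Nat.add_le_add h₁ h₂, .seq e₁ e₂⟩
  | ite b p q ihp ihq =>
    by_cases hb : b.Holds s
    · obtain ⟨t, h, e⟩ := ihp hp.1 s
      refine ⟨b.cost + 1 + t, by simp only [maxCost]; omega, ?_⟩
      rw [run, if_pos hb]
      exact .ite_true hb e
    · obtain ⟨t, h, e⟩ := ihq hp.2 s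
      refine ⟨b.cost + 1 + t, by simp only [maxCost]; omega, ?_⟩
      rw [run, if_neg hb]
      exact .ite_false hb e
  | loop b p => exact hp.elim

/-- A loop with a loop-free body terminates if each pass keeps the invariant `I` and decreases the
potential `φ`. -/
theorem exec_loop {b : Test} {p : Prog} (hp : p.LoopFree) (I : Store → Prop) (φ : Store → ℕ)
    (step : ∀ s, I s → b.Holds s → I (p.run s) ∧ φ (p.run s) < φ s) {s : Store} (hs : I s) :
    ∃ t s', Exec (.loop b p) s t s' ∧ t ≤ (φ s + 1) * (b.cost + 1 + p.maxCost) ∧ I s' ∧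
      ¬ b.Holds s' := by
  induction hk : φ s using Nat.strong_induction_on generalizing s with
  | _ k ih =>
    by_cases hb : b.Holds s
    · obtain ⟨h₁, h₂⟩ := step s hs hb
      obtain ⟨t₁, ht₁, e₁⟩ := p.exec_run hp s
      obtain ⟨t, s', e, ht, hI, hn⟩ := ih _ (hk ▸ h₂) h₁ rfl
      refine ⟨b.cost + 1 + t₁ + t, s', .loop_step hb e₁ e, ?_, hI, hn⟩
      calc b.cost + 1 + t₁ + t
          ≤ (b.cost + 1 + p.maxCost) + (φ (p.run s) + 1) * (b.cost + 1 + p.maxCost) := by omega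
        _ = (φ (p.run s) + 1 + 1) * (b.cost + 1 + p.maxCost) := by ring
        _ ≤ (k + 1) * (b.cost + 1 + p.maxCost) := Nat.mul_le_mul_right _ (by omega)
    · exact ⟨_, s, Exec.loop_stop hb, by nlinarith, hs, hb⟩

/-! ### Combinators for programs and tests -/

/-- The program `p`, started in memory `s`, halts within `T` steps with a memory satisfying `Q`. -/
def Halts (p : Prog) (s : Store) (T : ℕ) (Q : Store → Prop) : Prop :=
  ∃ t s', Exec p s t s' ∧ t ≤ T ∧ Q s'

theorem Halts.seq {p q : Prog} {s : Store} {T₁ T₂ : ℕ} {Q R : Store → Prop}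
    (hp : Halts p s T₁ Q) (hq : ∀ s', Q s' → Halts q s' T₂ R) :
    Halts (.seq p q) s (T₁ + T₂) R := by
  obtain ⟨t₁, s₁, e₁, h₁, hQ⟩ := hp
  obtain ⟨t₂, s₂, e₂, h₂, hR⟩ := hq s₁ hQ
  exact ⟨_, s₂, .seq e₁ e₂, Nat.add_le_add h₁ h₂, hR⟩

theorem Halts.of_loopFree {p : Prog} (hp : p.LoopFree) {s : Store} {Q : Store → Prop}
    (h : Q (p.run s)) : Halts p s p.maxCost Q := by
  obtain ⟨t, ht, e⟩ := p.exec_run hp s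
  exact ⟨t, _, e, ht, h⟩

/-- Run the programs of a list one after the other. -/
def Prog.seqList : List Prog → Prog
  | [] => .skip
  | p :: l => .seq p (seqList l)

theorem Prog.loopFree_seqList {l : List Prog} (h : ∀ p ∈ l, p.LoopFree) : (seqList l).LoopFree := by
  induction l with
  | nil => trivial
  | cons p l ih =>
    exact ⟨h p List.mem_cons_self, ih fun q hq => h q (List.mem_cons_of_mem _ hq)⟩

/-- Some test of the list holds. -/
def Test.any : List Test → Test
  | [] => .lt (.lit 0) (.lit 0)
  | b :: l => .not (.and (.not b) (.not (any l)))

theorem Test.holds_any {l : List Test} {s : Store} : (any l).Holds s ↔ ∃ b ∈ l, b.Holds s := by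
  induction l with
  | nil => simp [any, Holds, Expr.eval]
  | cons b l ih =>
    simp only [any, Holds, ih, List.mem_cons, exists_eq_or_imp]
    rw [not_and_or, not_not, not_not]

/-- Run the program belonging to the first test of the list that holds. -/
def Prog.firstOf : List (Test × Prog) → Prog
  | [] => .skip
  | (b, p) :: l => .ite b p (firstOf l)

theorem Prog.loopFree_firstOf {l : List (Test × Prog)} (h : ∀ bp ∈ l, bp.2.LoopFree) :
    (firstOf l).LoopFree := by
  induction l with
  | nil => trivial
  | cons bp l ih =>
    exact ⟨h bp List.mem_cons_self, ih fun q hq => h q (List.mem_cons_of_mem _ hq)⟩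

theorem Prog.exists_run_firstOf {l : List (Test × Prog)} {s : Store}
    (h : ∃ bp ∈ l, bp.1.Holds s) :
    ∃ bp ∈ l, bp.1.Holds s ∧ (firstOf l).run s = bp.2.run s := by
  induction l with
  | nil => simp at h
  | cons bp l ih =>
    by_cases hb : bp.1.Holds s
    · exact ⟨bp, List.mem_cons_self, hb, by rw [firstOf, run, if_pos hb]⟩
    · obtain ⟨bp', h', hb'⟩ := h
      obtain rfl | h' := List.mem_cons.1 h'
      · exact absurd hb' hb
      · obtain ⟨c, hc, hcs, he⟩ := ih ⟨bp', h', hb'⟩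
        exact ⟨c, List.mem_cons_of_mem _ hc, hcs, by rw [firstOf, run, if_neg hb, he]⟩

/-- Apply the successor `k` times. -/
def Expr.addLit (e : Expr) : ℕ → Expr
  | 0 => e
  | k + 1 => .succ (e.addLit k)

/-- Apply the predecessor `k` times. -/
def Expr.subLit (e : Expr) : ℕ → Expr
  | 0 => e
  | k + 1 => .pred (e.subLit k)

@[simp]
theorem Expr.eval_addLit (e : Expr) (k : ℕ) (s : Store) : (e.addLit k).eval s = e.eval s + k := by
  induction k with
  | zero => rfl
  | succ k ih => simp [addLit, eval, ih]; omega

@[simp]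
theorem Expr.eval_subLit (e : Expr) (k : ℕ) (s : Store) : (e.subLit k).eval s = e.eval s - k := by
  induction k with
  | zero => rfl
  | succ k ih => simp [subLit, eval, ih]; omega

@[simp]
theorem Store.reg_setReg (s : Store) (r v r' : ℕ) :
    (s.setReg r v).reg r' = if r' = r then v else s.reg r' := by
  simp [Store.setReg, Function.update_apply]

@[simp]
theorem Store.arr_setReg (s : Store) (r v : ℕ) : (s.setReg r v).arr = s.arr := rfl

@[simp]
theorem Store.reg_setCell (s : Store) (a i v : ℕ) : (s.setCell a i v).reg = s.reg := rfl

@[simp]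
theorem Store.arr_setCell (s : Store) (a i v a' i' : ℕ) :
    (s.setCell a i v).arr a' i' = if a' = a ∧ i' = i then v else s.arr a' i' := by
  by_cases h : a' = a
  · subst h; simp [Store.setCell, Function.update_apply]
  · simp [Store.setCell, h]

/-! ### A linear-time program

The program removes edges one at a time as long as the bounds `WithinBounds` permit. For each pair
`τ` of degrees there is a stack which holds all present edges whose two ends have these degrees (and
possibly edges that had this type earlier).

* Register `2` is a loop variable, the registers `3`, `4`, `5`, `6` hold the slacks in the four
  inequalities of `WithinBounds`, `7` is the edge that is treated, `8` the edge to be pushed on a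
  stack and `9` is auxiliary.
* Array `2` marks the present edges, `3`, `4`, `5` hold the three edges at each vertex, and `6` holds
  the degrees. -/

/-- The possible pairs of degrees of the two ends of an edge. -/
def edgeTypes : List (ℕ × ℕ) :=
  [(1, 1), (1, 2), (1, 3), (2, 1), (2, 2), (2, 3), (3, 1), (3, 2), (3, 3)]

/-- The array that is used as the stack for edges of type `τ`, and the register for its size. -/
def stackId (τ : ℕ × ℕ) : ℕ := 10 * τ.1 + τ.2

theorem mem_edgeTypes {τ : ℕ × ℕ} :
    τ ∈ edgeTypes ↔ (1 ≤ τ.1 ∧ τ.1 ≤ 3) ∧ (1 ≤ τ.2 ∧ τ.2 ≤ 3) := by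
  obtain ⟨i, j⟩ := τ
  simp only [edgeTypes, List.mem_cons, Prod.mk.injEq, List.not_mem_nil, or_false]
  omega

theorem ten_lt_stackId {τ : ℕ × ℕ} (h : τ ∈ edgeTypes) : 10 < stackId τ := by
  rw [mem_edgeTypes] at h; unfold stackId; omega

theorem stackId_inj {τ σ : ℕ × ℕ} (hτ : τ ∈ edgeTypes) (hσ : σ ∈ edgeTypes) :
    stackId τ = stackId σ ↔ τ = σ := by
  rw [mem_edgeTypes] at hτ hσ
  rw [Prod.ext_iff]
  unfold stackId
  omega

/-- The total size of all stacks. -/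
def Store.stackSize (s : Store) : ℕ :=
  s.reg 11 + s.reg 12 + s.reg 13 + s.reg 21 + s.reg 22 + s.reg 23 + s.reg 31 + s.reg 32 + s.reg 33

theorem Store.stackSize_setReg_stackId (s : Store) {τ : ℕ × ℕ} (h : τ ∈ edgeTypes) (v : ℕ) :
    (s.setReg (stackId τ) v).stackSize + s.reg (stackId τ) = s.stackSize + v := by
  simp only [edgeTypes, List.mem_cons, List.not_mem_nil, or_false] at h
  rcases h with rfl | rfl | rfl | rfl | rfl | rfl | rfl | rfl | rfl <;>
    simp [stackSize, stackId] <;> omega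

/-- The edge `e` is present and its ends have the degrees given by `τ`. -/
def Store.HasType (s : Store) (τ : ℕ × ℕ) (e : ℕ) : Prop :=
  s.arr 2 e = 1 ∧ s.arr 6 (s.arr 0 e) = τ.1 ∧ s.arr 6 (s.arr 1 e) = τ.2

/-- The edge `e` is on the stack for type `τ`. -/
def Store.InStack (s : Store) (τ : ℕ × ℕ) (e : ℕ) : Prop :=
  ∃ k < s.reg (stackId τ), s.arr (stackId τ) k = e

/-- The edge `e` is on the stack for its type if it is present. -/
def Store.Stacked (s : Store) (e : ℕ) : Prop :=
  ∀ τ ∈ edgeTypes, s.HasType τ e → s.InStack τ e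

/-! ### Pushing edges on the stacks -/

/-- `s'` arises from `s` by pushing at most `k` elements on stacks, and changing auxiliary
registers. -/
structure Extends (s s' : Store) (k : ℕ) : Prop where
  reg : ∀ r < 8, s'.reg r = s.reg r
  arr : ∀ a < 10, s'.arr a = s.arr a
  size : ∀ τ ∈ edgeTypes, s.reg (stackId τ) ≤ s'.reg (stackId τ)
  stack : ∀ τ ∈ edgeTypes, ∀ i < s.reg (stackId τ), s'.arr (stackId τ) i = s.arr (stackId τ) i
  total : s'.stackSize ≤ s.stackSize + k

theorem Extends.refl (s : Store) (k : ℕ) : Extends s s k :=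
  ⟨fun _ _ => rfl, fun _ _ => rfl, fun _ _ => le_rfl, fun _ _ _ _ => rfl, Nat.le_add_right _ _⟩

theorem Extends.trans {s₁ s₂ s₃ : Store} {k l : ℕ} (h : Extends s₁ s₂ k) (h' : Extends s₂ s₃ l) :
    Extends s₁ s₃ (k + l) where
  reg r hr := (h'.reg r hr).trans (h.reg r hr)
  arr a ha := (h'.arr a ha).trans (h.arr a ha)
  size τ hτ := (h.size τ hτ).trans (h'.size τ hτ)
  stack τ hτ i hi :=
    (h'.stack τ hτ i (hi.trans_le (h.size τ hτ))).trans (h.stack τ hτ i hi)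
  total := by have := h.total; have := h'.total; omega

theorem Extends.hasType_iff {s s' : Store} {k : ℕ} (h : Extends s s' k) {τ : ℕ × ℕ} {e : ℕ} :
    s'.HasType τ e ↔ s.HasType τ e := by
  simp only [Store.HasType, h.arr 2 (by omega), h.arr 6 (by omega), h.arr 0 (by omega),
    h.arr 1 (by omega)]

theorem Extends.inStack {s s' : Store} {k : ℕ} (h : Extends s s' k) {τ : ℕ × ℕ}
    (hτ : τ ∈ edgeTypes) {e : ℕ} (he : s.InStack τ e) : s'.InStack τ e := by
  obtain ⟨i, hi, rfl⟩ := he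
  exact ⟨i, hi.trans_le (h.size τ hτ), h.stack τ hτ i hi⟩

theorem Extends.stacked {s s' : Store} {k : ℕ} (h : Extends s s' k) {e : ℕ} (he : s.Stacked e) :
    s'.Stacked e :=
  fun τ hτ ht => h.inStack hτ (he τ hτ (h.hasType_iff.1 ht))

theorem extends_setReg_eight (s : Store) (v : ℕ) : Extends s (s.setReg 8 v) 0 where
  reg r hr := by simp; omega
  arr _ _ := rfl
  size τ hτ := by
    have := ten_lt_stackId hτ
    rw [Store.reg_setReg, if_neg (by omega)]
  stack _ _ _ _ := rfl
  total := by simp [Store.stackSize]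

/-- Test whether the edge `e` has type `τ`. -/
def isType (τ : ℕ × ℕ) (e : Expr) : Test :=
  .and (.eq (.cell 2 e) (.lit 1))
    (.and (.eq (.cell 6 (.cell 0 e)) (.lit τ.1)) (.eq (.cell 6 (.cell 1 e)) (.lit τ.2)))

theorem holds_isType {τ : ℕ × ℕ} {e : Expr} {s : Store} :
    (isType τ e).Holds s ↔ s.HasType τ (e.eval s) := Iff.rfl

/-- Push the edge in register `8` on the stack for type `τ` if it has this type. -/
def push (τ : ℕ × ℕ) : Prog :=
  .ite (isType τ (.reg 8))
    (.seq (.setCell (stackId τ) (.reg (stackId τ)) (.reg 8))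
      (.setReg (stackId τ) (.succ (.reg (stackId τ))))) .skip

theorem run_push {τ : ℕ × ℕ} (hτ : τ ∈ edgeTypes) (s : Store) :
    Extends s ((push τ).run s) 1 ∧ ((push τ).run s).reg 8 = s.reg 8 ∧
      (s.HasType τ (s.reg 8) → ((push τ).run s).InStack τ (s.reg 8)) := by
  have h10 := ten_lt_stackId hτ
  by_cases ht : s.HasType τ (s.reg 8)
  · rw [push, Prog.run, if_pos (holds_isType.2 ht)]
    simp only [Prog.run, Expr.eval]
    refine ⟨⟨fun r hr => ?_, fun a ha => ?_, fun σ hσ => ?_, fun σ hσ i hi => ?_, ?_⟩, ?_, ?_⟩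
    · simp; omega
    · ext i; simp; omega
    · simp only [Store.reg_setReg, Store.reg_setCell]
      split_ifs with h
      · rw [h]; omega
      · rfl
    · simp only [Store.arr_setReg, Store.arr_setCell]
      refine if_neg ?_
      rintro ⟨h, rfl⟩
      rw [h] at hi
      exact lt_irrefl _ hi
    · have := (s.setCell (stackId τ) (s.reg (stackId τ)) (s.reg 8)).stackSize_setReg_stackId hτ
        (s.reg (stackId τ) + 1)
      simp only [Store.reg_setCell] at this ⊢
      have h2 : (s.setCell (stackId τ) (s.reg (stackId τ)) (s.reg 8)).stackSize = s.stackSize := rfl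
      omega
    · simp; omega
    · exact fun _ => ⟨s.reg (stackId τ), by simp, by simp⟩
  · rw [push, Prog.run, if_neg (fun h => ht (holds_isType.1 h))]
    exact ⟨.refl _ _, rfl, fun h => absurd h ht⟩

/-- Push the edge `e` on the stack for its type. -/
def pushEdge (e : Expr) : Prog :=
  .seq (.setReg 8 e) (.seqList (edgeTypes.map push))

theorem loopFree_pushEdge (e : Expr) : (pushEdge e).LoopFree := by
  refine ⟨trivial, Prog.loopFree_seqList ?_⟩
  simp only [List.mem_map]
  rintro _ ⟨τ, -, rfl⟩
  exact ⟨⟨trivial, trivial⟩, trivial⟩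

/-- The bound 9 allows one push for each of the nine type tests, although at most one of them
succeeds. -/
theorem run_pushEdge (e : Expr) (s : Store) :
    Extends s ((pushEdge e).run s) 9 ∧ ((pushEdge e).run s).Stacked (e.eval s) := by
  have key : ∀ (l : List (ℕ × ℕ)), (∀ τ ∈ l, τ ∈ edgeTypes) → ∀ s : Store,
      Extends s ((Prog.seqList (l.map push)).run s) l.length ∧
        ∀ τ ∈ l, s.HasType τ (s.reg 8) →
          ((Prog.seqList (l.map push)).run s).InStack τ (s.reg 8) := by
    intro l
    induction l with
    | nil => exact fun _ s => ⟨.refl _ _, by simp⟩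
    | cons σ l ih =>
      intro hl s
      obtain ⟨h1, h8, h2⟩ := run_push (hl σ List.mem_cons_self) s
      obtain ⟨h3, h4⟩ := ih (fun τ hτ => hl τ (List.mem_cons_of_mem _ hτ)) ((push σ).run s)
      rw [List.length_cons, add_comm]
      refine ⟨h1.trans h3, fun τ hτ ht => ?_⟩
      obtain rfl | hτ := List.mem_cons.1 hτ
      · exact h3.inStack (hl τ List.mem_cons_self) (h2 ht)
      · have := h4 τ hτ
        rw [h8] at this
        exact this (h1.hasType_iff.2 ht)
  obtain ⟨h1, h2⟩ := key edgeTypes (fun _ h => h) (s.setReg 8 (e.eval s))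
  have h8 : (s.setReg 8 (e.eval s)).reg 8 = e.eval s := by simp
  rw [h8] at h2
  have h3 := (extends_setReg_eight s (e.eval s)).trans h1
  exact ⟨h3, fun τ hτ ht => h2 τ hτ
    ((extends_setReg_eight s _).hasType_iff.2 (h3.hasType_iff.1 ht))⟩

/-- Later expressions are evaluated after earlier pushes; `hl` says that pushing does not affect
their values. -/
theorem run_pushEdge_list {l : List Expr}
    (hl : ∀ e ∈ l, ∀ s s' k, Extends s s' k → e.eval s' = e.eval s) (s : Store) :
    Extends s ((Prog.seqList (l.map pushEdge)).run s) (9 * l.length) ∧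
      ∀ e ∈ l, ((Prog.seqList (l.map pushEdge)).run s).Stacked (e.eval s) := by
  induction l generalizing s with
  | nil => exact ⟨.refl _ _, by simp⟩
  | cons f l ih =>
    obtain ⟨h1, h2⟩ := run_pushEdge f s
    obtain ⟨h3, h4⟩ := ih (fun e he => hl e (List.mem_cons_of_mem _ he)) ((pushEdge f).run s)
    rw [List.length_cons, Nat.mul_add, add_comm]
    refine ⟨h1.trans h3, fun e he => ?_⟩
    obtain rfl | he := List.mem_cons.1 he
    · exact h3.stacked h2
    · have := h4 e he
      rwa [hl e (List.mem_cons_of_mem _ he) _ _ _ h1] at this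

/-! ### Edge sets in memory and the deletion step -/

open Finset

/-- The memory `s` represents the edge set `H` of the multigraph with the edges `0, …, m - 1`, where
`e` has the ends `x e` and `y e`. -/
structure Represents (x y : ℕ → ℕ) (n m : ℕ) (H : Finset ℕ) (s : Store) : Prop where
  subset : H ⊆ range m
  ends : ∀ e < m, s.arr 0 e = x e ∧ s.arr 1 e = y e
  mark : ∀ e, s.arr 2 e = if e ∈ H then 1 else 0
  degree : ∀ v, s.arr 6 v = endDegree x y H v
  slack₀ : s.reg 3 + endDegreeCount x y (range n) H 0 = (n + 2) / 4
  slack₁ : s.reg 4 + endDegreeCount x y (range n) H 1 = n / 4 + 1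
  slack₂ : s.reg 5 + endDegreeCount x y (range n) H 2 = (n + 2) / 4 + 1
  slack₃ : s.reg 6 + endDegreeCount x y (range n) H 2 = endDegreeCount x y (range n) H 0 + 2
  incident : ∀ e < m, ∀ v, x e = v ∨ y e = v →
    e = s.arr 3 v ∨ e = s.arr 4 v ∨ e = s.arr 5 v

variable {x y : ℕ → ℕ} {n m : ℕ} {H : Finset ℕ} {s s' : Store}

theorem Represents.extends {k : ℕ} (h : Represents x y n m H s) (hs : Extends s s' k) :
    Represents x y n m H s' where
  subset := h.subset
  ends := by rw [hs.arr 0 (by omega), hs.arr 1 (by omega)]; exact h.ends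
  mark := by rw [hs.arr 2 (by omega)]; exact h.mark
  degree := by rw [hs.arr 6 (by omega)]; exact h.degree
  slack₀ := by rw [hs.reg 3 (by omega)]; exact h.slack₀
  slack₁ := by rw [hs.reg 4 (by omega)]; exact h.slack₁
  slack₂ := by rw [hs.reg 5 (by omega)]; exact h.slack₂
  slack₃ := by rw [hs.reg 6 (by omega)]; exact h.slack₃
  incident := by
    rw [hs.arr 3 (by omega), hs.arr 4 (by omega), hs.arr 5 (by omega)]; exact h.incident

theorem Represents.hasType_iff (h : Represents x y n m H s) {τ : ℕ × ℕ} {e : ℕ} :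
    s.HasType τ e ↔ e ∈ H ∧ endDegree x y H (x e) = τ.1 ∧ endDegree x y H (y e) = τ.2 := by
  unfold Store.HasType
  rw [h.mark e]
  by_cases he : e ∈ H
  · have hm := mem_range.1 (h.subset he)
    simp [he, (h.ends e hm).1, (h.ends e hm).2, h.degree]
  · simp [he]

/-- The number of ends of degree `k` of an edge of type `τ`. -/
def endsOfDegree (τ : ℕ × ℕ) (k : ℕ) : ℕ :=
  (if τ.1 = k then 1 else 0) + (if τ.2 = k then 1 else 0)

/-- Test whether the removal of an edge of type `τ` respects the bounds. -/
def removable (τ : ℕ × ℕ) : Test :=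
  .and (.not (.lt (.reg 3) (.lit (endsOfDegree τ 1))))
    (.and (.not (.lt (Expr.addLit (.reg 4) (endsOfDegree τ 1)) (.lit (endsOfDegree τ 2))))
      (.and (.not (.lt (Expr.addLit (.reg 5) (endsOfDegree τ 2)) (.lit (endsOfDegree τ 3))))
        (.not (.lt (Expr.addLit (.reg 6) (endsOfDegree τ 1 + endsOfDegree τ 2))
          (.lit (endsOfDegree τ 3))))))

/-- These inequalities say that the four slacks stay nonnegative: an end of degree `k` moves from
class `k` to class `k - 1`. The terms that increase a slack stand on its side, as there are no
negative numbers. -/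
theorem holds_removable {τ : ℕ × ℕ} :
    (removable τ).Holds s ↔ endsOfDegree τ 1 ≤ s.reg 3 ∧
      endsOfDegree τ 2 ≤ s.reg 4 + endsOfDegree τ 1 ∧
      endsOfDegree τ 3 ≤ s.reg 5 + endsOfDegree τ 2 ∧
      endsOfDegree τ 3 ≤ s.reg 6 + (endsOfDegree τ 1 + endsOfDegree τ 2) := by
  simp only [removable, Test.Holds, Expr.eval_addLit, Expr.eval, not_lt]

/-- Remove the edge in register `7`, which has type `τ`, and update degrees and slacks. -/
def unmark (τ : ℕ × ℕ) : Prog :=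
  .seqList [.setCell 2 (.reg 7) (.lit 0),
    .setCell 6 (.cell 0 (.reg 7)) (.pred (.cell 6 (.cell 0 (.reg 7)))),
    .setCell 6 (.cell 1 (.reg 7)) (.pred (.cell 6 (.cell 1 (.reg 7)))),
    .setReg 6 (Expr.subLit (.addLit (.reg 6) (endsOfDegree τ 1 + endsOfDegree τ 2))
      (endsOfDegree τ 3)),
    .setReg 5 (Expr.subLit (.addLit (.reg 5) (endsOfDegree τ 2)) (endsOfDegree τ 3)),
    .setReg 4 (Expr.subLit (.addLit (.reg 4) (endsOfDegree τ 1)) (endsOfDegree τ 2)),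
    .setReg 3 (Expr.subLit (.reg 3) (endsOfDegree τ 1))]

/-- The edges at the ends of the edge in register `7`. -/
def incidentEdges : List Expr :=
  [.cell 3 (.cell 0 (.reg 7)), .cell 4 (.cell 0 (.reg 7)), .cell 5 (.cell 0 (.reg 7)),
    .cell 3 (.cell 1 (.reg 7)), .cell 4 (.cell 1 (.reg 7)), .cell 5 (.cell 1 (.reg 7))]

/-- Take the top edge of the stack for type `τ` to register `7`. -/
def pop (τ : ℕ × ℕ) : Prog :=
  .seq (.setReg (stackId τ) (.pred (.reg (stackId τ))))
    (.setReg 7 (.cell (stackId τ) (.reg (stackId τ))))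

/-- Pop an edge from the stack for type `τ` and remove it if it has this type. -/
def process (τ : ℕ × ℕ) : Prog :=
  .seq (pop τ)
    (.ite (isType τ (.reg 7)) (.seq (unmark τ) (.seqList (incidentEdges.map pushEdge))) .skip)

theorem loopFree_process (τ : ℕ × ℕ) : (process τ).LoopFree := by
  refine ⟨⟨trivial, trivial⟩, ⟨?_, Prog.loopFree_seqList ?_⟩, trivial⟩
  · simp [unmark, Prog.seqList, Prog.LoopFree]
  · simp only [List.mem_map]
    rintro _ ⟨e, -, rfl⟩
    exact loopFree_pushEdge e

/-- The test `removable` ensures that no subtraction from a slack is truncated. The stacks are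
untouched, hence the clauses on indices from 10 on. -/
theorem Represents.unmark_spec (h : Represents x y n m H s) (hne : ∀ e < m, x e ≠ y e)
    (hn : ∀ e < m, x e < n ∧ y e < n) {τ : ℕ × ℕ}
    (ht : s.HasType τ (s.reg 7)) (hr : (removable τ).Holds s) :
    Represents x y n m (H.erase (s.reg 7)) ((unmark τ).run s) ∧
      ((unmark τ).run s).reg 7 = s.reg 7 ∧
      (∀ r ≥ 10, ((unmark τ).run s).reg r = s.reg r) ∧
      (∀ a ≥ 10, ((unmark τ).run s).arr a = s.arr a) := by
  obtain ⟨e, he⟩ : ∃ e, s.reg 7 = e := ⟨_, rfl⟩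
  rw [he] at ht ⊢
  obtain ⟨heH, hτ1, hτ2⟩ := h.hasType_iff.1 ht
  obtain ⟨r0, r1, r2, r3⟩ := holds_removable.1 hr
  have hem := mem_range.1 (h.subset heH)
  have hxe := (h.ends e hem).1
  have hye := (h.ends e hem).2
  have hxy := hne e hem
  have hc := fun k => endDegreeCount_erase (V := range n) heH (mem_range.2 (hn e hem).1)
    (mem_range.2 (hn e hem).2) hxy k
  rw [hτ1, hτ2] at hc
  have hc0 := hc 0
  have hc1 := hc 1
  have hc2 := hc 2
  have hdx := one_le_endDegree_left (x := x) (y := y) heH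
  have hdy := one_le_endDegree_right (x := x) (y := y) heH
  have h10 : τ.1 ≠ 0 := by omega
  have h20 : τ.2 ≠ 0 := by omega
  simp only [h10, h20, if_false, zero_add, Nat.reduceAdd, add_zero] at hc0 hc1 hc2
  have a0 : ∀ i, ((unmark τ).run s).arr 0 i = s.arr 0 i := by
    intro i; simp [unmark, Prog.seqList, Prog.run]
  have a1 : ∀ i, ((unmark τ).run s).arr 1 i = s.arr 1 i := by
    intro i; simp [unmark, Prog.seqList, Prog.run]
  have a2 : ∀ i, ((unmark τ).run s).arr 2 i = if i = e then 0 else s.arr 2 i := by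
    intro i; simp [unmark, Prog.seqList, Prog.run, Expr.eval, he]
  have a3 : ∀ i, ((unmark τ).run s).arr 3 i = s.arr 3 i := by
    intro i; simp [unmark, Prog.seqList, Prog.run]
  have a4 : ∀ i, ((unmark τ).run s).arr 4 i = s.arr 4 i := by
    intro i; simp [unmark, Prog.seqList, Prog.run]
  have a5 : ∀ i, ((unmark τ).run s).arr 5 i = s.arr 5 i := by
    intro i; simp [unmark, Prog.seqList, Prog.run]
  -- Since `x e ≠ y e`, the second decrement reads a cell that the first one did not change.
  have a6 : ∀ i, ((unmark τ).run s).arr 6 i =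
      if i = y e then s.arr 6 (y e) - 1 else if i = x e then s.arr 6 (x e) - 1 else s.arr 6 i := by
    intro i
    simp [unmark, Prog.seqList, Prog.run, Expr.eval, he, hxe, hye, hxy.symm]
  have g3 : ((unmark τ).run s).reg 3 = s.reg 3 - endsOfDegree τ 1 := by
    simp [unmark, Prog.seqList, Prog.run, Expr.eval]
  have g4 : ((unmark τ).run s).reg 4 = s.reg 4 + endsOfDegree τ 1 - endsOfDegree τ 2 := by
    simp [unmark, Prog.seqList, Prog.run, Expr.eval]
  have g5 : ((unmark τ).run s).reg 5 = s.reg 5 + endsOfDegree τ 2 - endsOfDegree τ 3 := by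
    simp [unmark, Prog.seqList, Prog.run, Expr.eval]
  have g6 : ((unmark τ).run s).reg 6 =
      s.reg 6 + (endsOfDegree τ 1 + endsOfDegree τ 2) - endsOfDegree τ 3 := by
    simp [unmark, Prog.seqList, Prog.run, Expr.eval]
  refine ⟨⟨(erase_subset _ _).trans h.subset, ?_, ?_, ?_, ?_, ?_, ?_, ?_, ?_⟩, ?_, ?_, ?_⟩
  · intro i hi; rw [a0, a1]; exact h.ends i hi
  · intro i
    simp only [a2, h.mark i, mem_erase]
    by_cases hi : i = e <;> simp [hi]
  · intro v
    have hd := endDegree_erase (x := x) (y := y) heH v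
    rw [a6, h.degree, h.degree, h.degree]
    by_cases h1 : v = y e
    · subst h1
      simp only [hxy, if_true, if_false] at hd ⊢
      omega
    · by_cases h2 : v = x e
      · subst h2
        simp only [hxy, hxy.symm, if_true, if_false] at hd ⊢
        omega
      · simp only [h1, h2, Ne.symm h1, Ne.symm h2, if_false] at hd ⊢
        omega
  · rw [g3]; have := h.slack₀; unfold endsOfDegree at r0 ⊢; omega
  · rw [g4]; have := h.slack₁; unfold endsOfDegree at r1 ⊢; omega
  · rw [g5]; have := h.slack₂; unfold endsOfDegree at r2 ⊢; omega
  · rw [g6]; have := h.slack₃; unfold endsOfDegree at r3 ⊢; omega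
  · intro i hi v hv
    rw [a3, a4, a5]
    exact h.incident i hi v hv
  · simp [unmark, Prog.seqList, Prog.run, he]
  · intro r hr
    have : r ≠ 3 ∧ r ≠ 4 ∧ r ≠ 5 ∧ r ≠ 6 := by omega
    simp [unmark, Prog.seqList, Prog.run, this]
  · intro a ha
    have : a ≠ 2 ∧ a ≠ 6 := by omega
    ext i
    simp [unmark, Prog.seqList, Prog.run, this]

/-- Popping can hurt only the popped edge, and only if it has type `τ`; otherwise the lost entry was
stale. -/
theorem pop_spec {τ : ℕ × ℕ} (hτ : τ ∈ edgeTypes) (hs : 0 < s.reg (stackId τ)) :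
    (∀ r < 7, ((pop τ).run s).reg r = s.reg r) ∧ ((pop τ).run s).arr = s.arr ∧
      ((pop τ).run s).stackSize + 1 = s.stackSize ∧
      ∀ e, (e = ((pop τ).run s).reg 7 → ¬ ((pop τ).run s).HasType τ e) → s.Stacked e →
        ((pop τ).run s).Stacked e := by
  have h10 := ten_lt_stackId hτ
  have h7 : ∀ σ ∈ edgeTypes, stackId σ ≠ 7 := fun σ hσ => by
    have := ten_lt_stackId hσ; omega
  simp only [pop, Prog.run, Expr.eval]
  refine ⟨fun r hr => ?_, rfl, ?_, fun e he hst σ hσ ht => ?_⟩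
  · simp only [Store.reg_setReg]
    rw [if_neg (by omega), if_neg (by omega)]
  · have h1 := s.stackSize_setReg_stackId hτ (s.reg (stackId τ) - 1)
    have h2 : ∀ (s : Store) v, (s.setReg 7 v).stackSize = s.stackSize := fun s v => by
      simp [Store.stackSize]
    rw [h2]
    omega
  · obtain ⟨k, hk, hke⟩ := hst σ hσ ht
    refine ⟨k, ?_, hke⟩
    simp only [Store.reg_setReg, if_neg (h7 σ hσ), stackId_inj hσ hτ]
    split_ifs with h
    · subst h
      refine lt_of_le_of_ne (Nat.le_sub_one_of_lt hk) ?_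
      rintro rfl
      refine he ?_ ht
      simp [hke]
    · exact hk

theorem Represents.congr (h : Represents x y n m H s) (hr : ∀ r < 7, s'.reg r = s.reg r)
    (ha : s'.arr = s.arr) : Represents x y n m H s' where
  subset := h.subset
  ends := by rw [ha]; exact h.ends
  mark := by rw [ha]; exact h.mark
  degree := by rw [ha]; exact h.degree
  slack₀ := by rw [hr 3 (by omega)]; exact h.slack₀
  slack₁ := by rw [hr 4 (by omega)]; exact h.slack₁
  slack₂ := by rw [hr 5 (by omega)]; exact h.slack₂
  slack₃ := by rw [hr 6 (by omega)]; exact h.slack₃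
  incident := by rw [ha]; exact h.incident

theorem Store.InStack.congr {τ : ℕ × ℕ} {e : ℕ} (h : s.InStack τ e) (hτ : τ ∈ edgeTypes)
    (hr : ∀ r ≥ 10, s'.reg r = s.reg r) (ha : ∀ a ≥ 10, s'.arr a = s.arr a) : s'.InStack τ e := by
  have h10 := ten_lt_stackId hτ
  obtain ⟨k, hk, hke⟩ := h
  exact ⟨k, by rwa [hr _ h10.le], by rwa [ha _ h10.le]⟩

theorem eval_of_mem_incidentEdges {e : Expr} (he : e ∈ incidentEdges) (s s' : Store) (k : ℕ)
    (h : Extends s s' k) : e.eval s' = e.eval s := by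
  have h7 := h.reg 7 (by omega)
  have h0 := h.arr 0 (by omega)
  have h1 := h.arr 1 (by omega)
  have h3 := h.arr 3 (by omega)
  have h4 := h.arr 4 (by omega)
  have h5 := h.arr 5 (by omega)
  simp only [incidentEdges, List.mem_cons, List.not_mem_nil, or_false] at he
  rcases he with rfl | rfl | rfl | rfl | rfl | rfl <;> simp only [Expr.eval, h7, h0, h1, h3, h4, h5]

/-- A deletion causes at most `6 * 9 = 54` pushes, fewer than the 55 units released by the deleted
edge. If the popped entry is stale, the pop alone lowers the potential. -/
theorem Represents.process_spec (h : Represents x y n m H s) (hst : ∀ e, s.Stacked e)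
    (hne : ∀ e < m, x e ≠ y e) (hn : ∀ e < m, x e < n ∧ y e < n) {τ : ℕ × ℕ} (hτ : τ ∈ edgeTypes)
    (hr : (removable τ).Holds s) (hs : 0 < s.reg (stackId τ)) :
    ∃ H', Represents x y n m H' ((process τ).run s) ∧ (∀ e, ((process τ).run s).Stacked e) ∧
      ((process τ).run s).stackSize + 55 * #H' < s.stackSize + 55 * #H := by
  obtain ⟨p1, p2, p3, p4⟩ := pop_spec hτ hs
  have hrun : (process τ).run s = (Prog.ite (isType τ (.reg 7))
      (.seq (unmark τ) (.seqList (incidentEdges.map pushEdge))) .skip).run ((pop τ).run s) := rfl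
  rw [hrun]
  generalize (pop τ).run s = s₁ at p1 p2 p3 p4 ⊢
  have h₁ := h.congr p1 p2
  have hr₁ : (removable τ).Holds s₁ := by
    rw [holds_removable, p1 3 (by omega), p1 4 (by omega), p1 5 (by omega), p1 6 (by omega)]
    exact holds_removable.1 hr
  by_cases ht : s₁.HasType τ (s₁.reg 7)
  · rw [Prog.run, if_pos (holds_isType.2 ht), Prog.run]
    obtain ⟨u1, u2, u3, u4⟩ := h₁.unmark_spec hne hn ht hr₁
    generalize (unmark τ).run s₁ = s₂ at u1 u2 u3 u4 ⊢
    obtain ⟨q1, q2⟩ := run_pushEdge_list (l := incidentEdges)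
      (fun e he => eval_of_mem_incidentEdges he) s₂
    obtain ⟨e₀, he₀⟩ : ∃ e, s₁.reg 7 = e := ⟨_, rfl⟩
    rw [he₀] at u1 u2 p4 ht
    have heH := (h₁.hasType_iff.1 ht).1
    have hem := mem_range.1 (h.subset heH)
    refine ⟨_, u1.extends q1, fun e => ?_, ?_⟩
    -- Edges meeting `e₀` have been pushed again under their new types; all others keep their type,
    -- so their old entries still serve.
    · by_cases hinc : e < m ∧ (x e = x e₀ ∨ y e = x e₀ ∨ x e = y e₀ ∨ y e = y e₀)
      · simp only [incidentEdges, List.mem_cons, List.not_mem_nil, or_false, forall_eq_or_imp,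
          forall_eq, Expr.eval, u2, (u1.ends e₀ hem).1, (u1.ends e₀ hem).2] at q2
        obtain ⟨q3, q4, q5, q6, q7, q8⟩ := q2
        obtain ⟨hlt, hinc⟩ := hinc
        have hv : (x e = x e₀ ∨ y e = x e₀) ∨ (x e = y e₀ ∨ y e = y e₀) := by tauto
        obtain hv | hv := hv
        · obtain hi | hi | hi := u1.incident e hlt _ hv
          · rw [← hi] at q3; exact q3
          · rw [← hi] at q4; exact q4
          · rw [← hi] at q5; exact q5
        · obtain hi | hi | hi := u1.incident e hlt _ hv
          · rw [← hi] at q6; exact q6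
          · rw [← hi] at q7; exact q7
          · rw [← hi] at q8; exact q8
      · refine q1.stacked fun σ hσ hσt => ?_
        obtain ⟨he, hσ1, hσ2⟩ := u1.hasType_iff.1 hσt
        obtain ⟨hne', heH'⟩ := mem_erase.1 he
        have hlt := mem_range.1 (h.subset heH')
        have hd1 := endDegree_erase (x := x) (y := y) heH (x e)
        have hd2 := endDegree_erase (x := x) (y := y) heH (y e)
        have c1 : x e₀ ≠ x e := fun hc => hinc ⟨hlt, .inl hc.symm⟩
        have c2 : x e₀ ≠ y e := fun hc => hinc ⟨hlt, .inr (.inl hc.symm)⟩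
        have c3 : y e₀ ≠ x e := fun hc => hinc ⟨hlt, .inr (.inr (.inl hc.symm))⟩
        have c4 : y e₀ ≠ y e := fun hc => hinc ⟨hlt, .inr (.inr (.inr hc.symm))⟩
        rw [if_neg c1, if_neg c3, hσ1] at hd1
        rw [if_neg c2, if_neg c4, hσ2] at hd2
        exact (p4 e (fun hc => absurd hc hne') (hst e) σ hσ (h₁.hasType_iff.2 ⟨heH', hd1.symm, hd2.symm⟩)).congr hσ u3 u4
    · have hq := q1.total
      have hu : s₂.stackSize = s₁.stackSize := by
        simp only [Store.stackSize]
        simp only [u3 _ (show 11 ≥ 10 by omega), u3 _ (show 12 ≥ 10 by omega),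
          u3 _ (show 13 ≥ 10 by omega), u3 _ (show 21 ≥ 10 by omega), u3 _ (show 22 ≥ 10 by omega),
          u3 _ (show 23 ≥ 10 by omega), u3 _ (show 31 ≥ 10 by omega), u3 _ (show 32 ≥ 10 by omega),
          u3 _ (show 33 ≥ 10 by omega)]
      have hl : incidentEdges.length = 6 := rfl
      have hcard := card_erase_add_one heH
      omega
  · rw [Prog.run, if_neg (fun hc => ht (holds_isType.1 hc)), Prog.run]
    refine ⟨H, h₁, fun e => ?_, by omega⟩
    exact p4 e (fun he hc => ht (he ▸ hc)) (hst e)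

/-! ### The removal loop -/

/-- Test whether the stack for type `τ` is to be processed. -/
def processTest (τ : ℕ × ℕ) : Test :=
  .and (removable τ) (.lt (.lit 0) (.reg (stackId τ)))

theorem holds_processTest {τ : ℕ × ℕ} :
    (processTest τ).Holds s ↔ (removable τ).Holds s ∧ 0 < s.reg (stackId τ) := Iff.rfl

/-- The test of `removalLoop`. -/
def removalTest : Test := .any (edgeTypes.map processTest)

/-- The body of `removalLoop`. -/
def removalBody : Prog := .firstOf (edgeTypes.map fun τ => (processTest τ, process τ))

/-- Remove edges as long as possible. -/
def removalLoop : Prog := .loop removalTest removalBody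

/-- The constant factor in the running time of `removalLoop`. -/
def removalCost : ℕ := removalTest.cost + 1 + removalBody.maxCost

/-- The edge set is recovered from the memory, so the potential is a function of the memory alone,
as `exec_loop` requires. -/
theorem Represents.filter_marked (h : Represents x y n m H s) :
    ({e ∈ range m | s.arr 2 e = 1} : Finset ℕ) = H := by
  ext e
  rw [mem_filter, h.mark e]
  by_cases he : e ∈ H
  · simpa [he] using h.subset he
  · simp [he]

theorem Represents.edgesWithinBounds (h : Represents x y n m H s) :
    EdgesWithinBounds x y (range n) H := by
  have h0 := h.slack₀
  have h1 := h.slack₁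
  have h2 := h.slack₂
  have h3 := h.slack₃
  unfold EdgesWithinBounds WithinBounds
  rw [card_range]
  omega

/-- A present edge lies on the stack for its type, so that stack is nonempty. Once all tests fail,
its type is therefore not removable, which in terms of slacks is a violated bound. -/
theorem Represents.not_edgesWithinBounds_erase (h : Represents x y n m H s)
    (hst : ∀ e, s.Stacked e) (hne : ∀ e < m, x e ≠ y e) (hn : ∀ e < m, x e < n ∧ y e < n)
    (h3 : ∀ v, endDegree x y H v ≤ 3)
    (hdone : ∀ τ ∈ edgeTypes, ¬ (processTest τ).Holds s) {e : ℕ} (he : e ∈ H) :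
    ¬ EdgesWithinBounds x y (range n) (H.erase e) := by
  intro hw
  have hem := mem_range.1 (h.subset he)
  have hτ : (endDegree x y H (x e), endDegree x y H (y e)) ∈ edgeTypes :=
    mem_edgeTypes.2 ⟨⟨one_le_endDegree_left he, h3 _⟩, one_le_endDegree_right he, h3 _⟩
  refine hdone _ hτ (holds_processTest.2 ⟨holds_removable.2 ?_, ?_⟩)
  · have hc := fun k => endDegreeCount_erase (V := range n) he (mem_range.2 (hn e hem).1)
      (mem_range.2 (hn e hem).2) (hne e hem) k
    have hc0 := hc 0
    have hc1 := hc 1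
    have hc2 := hc 2
    have hdx := one_le_endDegree_left (x := x) (y := y) he
    have hdy := one_le_endDegree_right (x := x) (y := y) he
    rw [if_neg (by omega), if_neg (by omega)] at hc0
    have s0 := h.slack₀
    have s1 := h.slack₁
    have s2 := h.slack₂
    have s3 := h.slack₃
    unfold EdgesWithinBounds WithinBounds at hw
    rw [card_range] at hw
    simp only [Nat.reduceAdd, zero_add] at hc0 hc1 hc2
    unfold endsOfDegree
    dsimp only
    omega
  · obtain ⟨k, hk, -⟩ := hst e _ hτ (h.hasType_iff.2 ⟨he, rfl, rfl⟩)
    exact Nat.zero_lt_of_lt hk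

theorem Represents.halts_removalLoop (h : Represents x y n m H s) (hst : ∀ e, s.Stacked e)
    (hne : ∀ e < m, x e ≠ y e) (hn : ∀ e < m, x e < n ∧ y e < n)
    (h3 : ∀ v, endDegree x y (range m) v ≤ 3) :
    Halts removalLoop s ((s.stackSize + 55 * #H + 1) * removalCost) fun s' =>
      ∃ H', Represents x y n m H' s' ∧
        ∀ e ∈ H', ¬ EdgesWithinBounds x y (range n) (H'.erase e) := by
  have hfree : removalBody.LoopFree := by
    refine Prog.loopFree_firstOf ?_
    simp only [List.mem_map]
    rintro _ ⟨τ, -, rfl⟩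
    exact loopFree_process τ
  have step : ∀ s, (∃ H, Represents x y n m H s ∧ ∀ e, s.Stacked e) → removalTest.Holds s →
      (∃ H, Represents x y n m H (removalBody.run s) ∧ ∀ e, (removalBody.run s).Stacked e) ∧
      (removalBody.run s).stackSize + 55 * #{e ∈ range m | (removalBody.run s).arr 2 e = 1} <
        s.stackSize + 55 * #{e ∈ range m | s.arr 2 e = 1} := by
    rintro s ⟨H, h, hst⟩ hb
    obtain ⟨b, hbm, hbs⟩ := Test.holds_any.1 hb
    obtain ⟨σ, hσ, rfl⟩ := List.mem_map.1 hbm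
    obtain ⟨bp, hbp, hbp', hrun⟩ := Prog.exists_run_firstOf
      (l := edgeTypes.map fun τ => (processTest τ, process τ)) (s := s)
      ⟨_, List.mem_map_of_mem hσ, hbs⟩
    obtain ⟨τ, hτ, rfl⟩ := List.mem_map.1 hbp
    obtain ⟨hr, hs⟩ := holds_processTest.1 hbp'
    obtain ⟨H', h', hst', hlt⟩ := h.process_spec hst hne hn hτ hr hs
    rw [removalBody, hrun]
    dsimp only
    rw [h.filter_marked, h'.filter_marked]
    exact ⟨⟨H', h', hst'⟩, hlt⟩
  obtain ⟨t, s', ex, ht, ⟨H', hH', hst'⟩, hb⟩ := exec_loop hfree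
    (fun s => ∃ H, Represents x y n m H s ∧ ∀ e, s.Stacked e)
    (fun s => s.stackSize + 55 * #{e ∈ range m | s.arr 2 e = 1}) step ⟨H, h, hst⟩
  rw [h.filter_marked] at ht
  refine ⟨t, s', ex, ht, H', hH', fun e he => ?_⟩
  refine hH'.not_edgesWithinBounds_erase hst' hne hn
    (fun v => (endDegree_mono hH'.subset v).trans (h3 v)) (fun τ hτ hc => hb ?_) he
  exact Test.holds_any.2 ⟨_, List.mem_map_of_mem hτ, hc⟩

/-! ### Initialization -/

/-- Compute the slacks of the empty degree counts. -/
def initSlacks : Prog :=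
  .seq (.seqList [.setReg 9 (.reg 0), .setReg 4 (.lit 1), .setReg 5 (.lit 1), .setReg 6 (.lit 2)])
    (.seq (.loop (.lt (.lit 3) (.reg 9))
        (.seqList [.setReg 9 (Expr.subLit (.reg 9) 4), .setReg 3 (.succ (.reg 3)),
          .setReg 4 (.succ (.reg 4)), .setReg 5 (.succ (.reg 5))]))
      -- Division by 4 is repeated subtraction; a remainder of 2 or 3 raises `(n + 2) / 4` but not
      -- `n / 4`.
      (.ite (.lt (.lit 1) (.reg 9))
        (.seq (.setReg 3 (.succ (.reg 3))) (.setReg 5 (.succ (.reg 5)))) .skip))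

theorem halts_initSlacks : ∃ c, ∀ (n m : ℕ) (x y : ℕ → ℕ),
    Halts initSlacks (inputStore n m x y) (c * (n + 1)) fun s =>
      s.arr = (inputStore n m x y).arr ∧ s.reg 1 = m ∧ s.reg 2 = 0 ∧ (∀ r ≥ 10, s.reg r = 0) ∧
        s.reg 3 = (n + 2) / 4 ∧ s.reg 4 = n / 4 + 1 ∧ s.reg 5 = (n + 2) / 4 + 1 ∧ s.reg 6 = 2 := by
  -- Loop invariant: register 9 holds what is left of `n`, and its quotients are still to be added
  -- to the slacks.
  let I : ℕ → ℕ → (ℕ → ℕ) → (ℕ → ℕ) → Store → Prop := fun n m x y s =>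
    s.arr = (inputStore n m x y).arr ∧ s.reg 1 = m ∧ s.reg 2 = 0 ∧ (∀ r ≥ 10, s.reg r = 0) ∧
      s.reg 3 + (s.reg 9 + 2) / 4 = (n + 2) / 4 ∧ s.reg 4 + s.reg 9 / 4 = n / 4 + 1 ∧
      s.reg 5 + (s.reg 9 + 2) / 4 = (n + 2) / 4 + 1 ∧ s.reg 6 = 2 ∧ s.reg 9 ≤ n
  obtain ⟨p, hp⟩ : ∃ p, p = Prog.seqList [.setReg 9 (Expr.subLit (.reg 9) 4),
    .setReg 3 (.succ (.reg 3)), .setReg 4 (.succ (.reg 4)), .setReg 5 (.succ (.reg 5))] := ⟨_, rfl⟩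
  refine ⟨100 + p.maxCost, fun n m x y => ?_⟩
  have hloop : ∀ s, I n m x y s → Halts (.loop (.lt (.lit 3) (.reg 9)) p) s
      ((n + 1) * (3 + 1 + p.maxCost)) fun s => I n m x y s ∧ s.reg 9 ≤ 3 := by
    intro s hs
    have step : ∀ s, I n m x y s → (Test.lt (.lit 3) (.reg 9)).Holds s →
        I n m x y (p.run s) ∧ (p.run s).reg 9 < s.reg 9 := by
      rintro s ⟨h0, h1, h2, h3, h4, h5, h6, h7, h8⟩ (hb : 3 < s.reg 9)
      have hr : ∀ r, (p.run s).reg r = if r = 5 then s.reg 5 + 1 else if r = 4 then s.reg 4 + 1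
          else if r = 3 then s.reg 3 + 1 else if r = 9 then s.reg 9 - 4 else s.reg r := by
        intro r
        rw [hp]
        simp [Prog.seqList, Prog.run, Expr.eval]
      have ha : (p.run s).arr = s.arr := by rw [hp]; rfl
      refine ⟨⟨ha.trans h0, ?_, ?_, ?_, ?_, ?_, ?_, ?_, ?_⟩, ?_⟩
      · simp [hr, h1]
      · simp [hr, h2]
      · intro r hr'
        rw [hr, if_neg (by omega), if_neg (by omega), if_neg (by omega), if_neg (by omega), h3 r hr']
      all_goals simp [hr]; omega
    obtain ⟨t, s', ex, ht, hI, hb⟩ := exec_loop (p := p)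
      (by rw [hp]; simp [Prog.seqList, Prog.LoopFree]) (I n m x y) (fun s => s.reg 9) step hs
    refine ⟨t, s', ex, ht.trans ?_, hI, not_lt.1 hb⟩
    exact Nat.mul_le_mul_right _ (Nat.succ_le_succ hs.2.2.2.2.2.2.2.2)
  have h1 : Halts (.seqList [.setReg 9 (.reg 0), .setReg 4 (.lit 1), .setReg 5 (.lit 1),
      .setReg 6 (.lit 2)]) (inputStore n m x y) 9 (I n m x y) := by
    refine Halts.of_loopFree (by simp [Prog.seqList, Prog.LoopFree]) ?_
    refine ⟨rfl, ?_, ?_, ?_, ?_, ?_, ?_, ?_, ?_⟩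
    case refine_3 =>
      intro r hr
      have : r ≠ 0 ∧ r ≠ 1 ∧ r ≠ 4 ∧ r ≠ 5 ∧ r ≠ 6 ∧ r ≠ 9 := by omega
      simp [Prog.seqList, Prog.run, Expr.eval, inputStore, this]
    all_goals simp [Prog.seqList, Prog.run, Expr.eval, inputStore]
    all_goals omega
  have hlast : ∀ s, I n m x y s ∧ s.reg 9 ≤ 3 →
      Halts (.ite (.lt (.lit 1) (.reg 9))
        (.seq (.setReg 3 (.succ (.reg 3))) (.setReg 5 (.succ (.reg 5)))) .skip) s 11
      fun s => s.arr = (inputStore n m x y).arr ∧ s.reg 1 = m ∧ s.reg 2 = 0 ∧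
        (∀ r ≥ 10, s.reg r = 0) ∧ s.reg 3 = (n + 2) / 4 ∧ s.reg 4 = n / 4 + 1 ∧
        s.reg 5 = (n + 2) / 4 + 1 ∧ s.reg 6 = 2 := by
    rintro s ⟨⟨h0, h1, h2, h3, h4, h5, h6, h7, -⟩, h9⟩
    refine Halts.of_loopFree (p := .ite (.lt (.lit 1) (.reg 9))
      (.seq (.setReg 3 (.succ (.reg 3))) (.setReg 5 (.succ (.reg 5)))) .skip)
      ⟨⟨trivial, trivial⟩, trivial⟩ ?_
    by_cases hb : (Test.lt (.lit 1) (.reg 9)).Holds s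
    · rw [Prog.run, if_pos hb]
      have hb' : 1 < s.reg 9 := hb
      refine ⟨h0, ?_, ?_, ?_, ?_, ?_, ?_, ?_⟩
      case refine_3 =>
        intro r hr
        have : r ≠ 5 ∧ r ≠ 3 := by omega
        simp [Prog.run, Expr.eval, this, h3 r hr]
      all_goals simp [Prog.run, Expr.eval]
      all_goals omega
    · rw [Prog.run, if_neg hb, Prog.run]
      have hb' : ¬ 1 < s.reg 9 := hb
      exact ⟨h0, h1, h2, h3, by omega, by omega, by omega, h7⟩
  obtain ⟨t, s, ex, ht, hs⟩ := h1.seq fun s hs => (hloop s hs).seq hlast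
  rw [hp] at ex
  refine ⟨t, s, ex, ht.trans ?_, hs⟩
  nlinarith [Nat.zero_le n, Nat.zero_le p.maxCost]

/-! ### Recording the edges at their ends -/

/-- Record the edge in register `2` at its end in array `a`. -/
def addEnd (a : ℕ) : Prog :=
  .seq
    (.ite (.eq (.cell 6 (.cell a (.reg 2))) (.lit 0)) (.setCell 3 (.cell a (.reg 2)) (.reg 2))
      (.ite (.eq (.cell 6 (.cell a (.reg 2))) (.lit 1)) (.setCell 4 (.cell a (.reg 2)) (.reg 2))
        (.setCell 5 (.cell a (.reg 2)) (.reg 2))))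
    (.setCell 6 (.cell a (.reg 2)) (.succ (.cell 6 (.cell a (.reg 2)))))

/-- The edge `e` is among the edges recorded at the vertex `v`. -/
def Store.Recorded (s : Store) (v e : ℕ) : Prop :=
  (1 ≤ s.arr 6 v ∧ s.arr 3 v = e) ∨ (2 ≤ s.arr 6 v ∧ s.arr 4 v = e) ∨
    (3 ≤ s.arr 6 v ∧ s.arr 5 v = e)

/-- The current degree is the number of occupied slots at `v`. The degree conditions in `Recorded`
exclude free slots, whose default 0 is also the name of an edge. -/
theorem run_addEnd {a v e : ℕ} (ha : a < 2) (s : Store) (he : s.reg 2 = e) (hv : s.arr a e = v) :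
    ((addEnd a).run s).reg = s.reg ∧
      (∀ b i, b < 3 → ((addEnd a).run s).arr b i = s.arr b i) ∧
      (∀ u, ((addEnd a).run s).arr 6 u = s.arr 6 u + if v = u then 1 else 0) ∧
      (s.arr 6 v ≤ 2 → (∀ u f, s.Recorded u f → ((addEnd a).run s).Recorded u f) ∧
        ((addEnd a).run s).Recorded v e) := by
  have ha' : a ≠ 3 ∧ a ≠ 4 ∧ a ≠ 5 ∧ a ≠ 6 := by omega
  have key : ∃ c, (c = if s.arr 6 v = 0 then 3 else if s.arr 6 v = 1 then 4 else 5) ∧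
      (addEnd a).run s = (s.setCell c v e).setCell 6 v (s.arr 6 v + 1) := by
    refine ⟨_, rfl, ?_⟩
    by_cases h0 : s.arr 6 v = 0
    · simp [addEnd, Prog.run, Test.Holds, Expr.eval, he, hv, h0, ha']
    · by_cases h1 : s.arr 6 v = 1
      · simp [addEnd, Prog.run, Test.Holds, Expr.eval, he, hv, h1, ha']
      · simp [addEnd, Prog.run, Test.Holds, Expr.eval, he, hv, h0, h1, ha']
  obtain ⟨c, hc, hrun⟩ := key
  have hc' : c = 3 ∨ c = 4 ∨ c = 5 := by split_ifs at hc <;> omega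
  rw [hrun]
  refine ⟨rfl, fun b i hb => ?_, fun u => ?_, fun h2 => ⟨fun u f hf => ?_, ?_⟩⟩
  · have h1 : b ≠ c := by omega
    have h2 : b ≠ 6 := by omega
    simp [h1, h2]
  · have h1 : 6 ≠ c := by omega
    simp only [Store.arr_setCell, true_and, h1, false_and, if_false]
    split_ifs with h3 h4 h4
    · rw [h3]
    · exact absurd h3.symm h4
    · exact absurd h4.symm h3
    · rfl
  · unfold Store.Recorded at hf ⊢
    by_cases hu : u = v
    · subst hu
      obtain rfl | rfl | rfl := hc' <;> simp at hc ⊢ <;> split_ifs at hc <;> omega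
    · simpa [hu] using hf
  · unfold Store.Recorded
    obtain rfl | rfl | rfl := hc' <;> simp at hc ⊢ <;> split_ifs at hc <;> omega

theorem endDegree_range_succ (x y : ℕ → ℕ) (k v : ℕ) :
    endDegree x y (range (k + 1)) v =
      endDegree x y (range k) v + (if x k = v then 1 else 0) + if y k = v then 1 else 0 := by
  have h := endDegree_erase (x := x) (y := y) (H := range (k + 1)) (self_mem_range_succ k) v
  have h' : (range (k + 1)).erase k = range k := by
    rw [range_add_one, erase_insert notMem_range_self]
  rw [h'] at h
  omega

/-- Mark an edge and record it at its ends. -/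
def recordBody : Prog :=
  .seq (addEnd 0) (.seq (addEnd 1)
    (.seq (.setCell 2 (.reg 2) (.lit 1)) (.setReg 2 (.succ (.reg 2)))))

/-- Mark all edges, record them at their ends and compute the degrees. -/
def recordLoop : Prog := .loop (.lt (.reg 2) (.reg 1)) recordBody

/-- The edges `0, …, s.reg 2 - 1` have been recorded. -/
structure Records (x y : ℕ → ℕ) (m : ℕ) (r : ℕ → ℕ) (s : Store) : Prop where
  le : s.reg 2 ≤ m
  reg : ∀ i ≠ 2, s.reg i = r i
  ends : ∀ e < m, s.arr 0 e = x e ∧ s.arr 1 e = y e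
  mark : ∀ e, s.arr 2 e = if e < s.reg 2 then 1 else 0
  degree : ∀ v, s.arr 6 v = endDegree x y (range (s.reg 2)) v
  recorded : ∀ e < s.reg 2, s.Recorded (x e) e ∧ s.Recorded (y e) e

theorem Records.run_recordBody {r : ℕ → ℕ} (h : Records x y m r s)
    (h3 : ∀ v, endDegree x y (range m) v ≤ 3) (hne : ∀ e < m, x e ≠ y e) (hlt : s.reg 2 < m) :
    Records x y m r (recordBody.run s) ∧ (recordBody.run s).reg 2 = s.reg 2 + 1 := by
  obtain ⟨k, hk⟩ : ∃ k, s.reg 2 = k := ⟨_, rfl⟩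
  have hlek := h.le
  have hmark := h.mark
  have hdeg := h.degree
  have hrec := h.recorded
  rw [hk] at hlt hlek hmark hdeg hrec
  -- The final degree is at most 3, so each end of edge `k` still finds a free slot.
  have hbound : ∀ v, endDegree x y (range k) v + (if x k = v then 1 else 0) +
      (if y k = v then 1 else 0) ≤ 3 := fun v => by
    rw [← endDegree_range_succ]
    exact (endDegree_mono (range_mono hlt) v).trans (h3 v)
  have hxy := hne k hlt
  obtain ⟨a1, a2, a3, a4⟩ := run_addEnd (a := 0) (by omega) s hk (h.ends k hlt).1
  obtain ⟨a5, a6⟩ := a4 (by have := hbound (x k); rw [if_pos rfl] at this; rw [hdeg]; omega)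
  have hrun : recordBody.run s = (Prog.seq (addEnd 1)
    (.seq (.setCell 2 (.reg 2) (.lit 1)) (.setReg 2 (.succ (.reg 2))))).run
      ((addEnd 0).run s) := rfl
  rw [hrun]
  generalize (addEnd 0).run s = s₁ at *
  have hk₁ : s₁.reg 2 = k := by rw [a1, hk]
  obtain ⟨b1, b2, b3, b4⟩ := run_addEnd (a := 1) (v := y k) (by omega) s₁ hk₁
    (by rw [a2 1 k (by omega)]; exact (h.ends k hlt).2)
  obtain ⟨b5, b6⟩ := b4 (by
    have := hbound (y k); rw [if_pos rfl] at this; rw [a3, hdeg]; omega)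
  rw [Prog.run]
  generalize (addEnd 1).run s₁ = s₂ at *
  have hk₂ : s₂.reg 2 = k := by rw [b1, hk₁]
  obtain ⟨s₃, hs₃⟩ : ∃ s₃, s₃ = (Prog.seq (.setCell 2 (.reg 2) (.lit 1))
    (.setReg 2 (.succ (.reg 2)))).run s₂ := ⟨_, rfl⟩
  rw [← hs₃]
  have r2 : s₃.reg 2 = k + 1 := by simp [hs₃, Prog.run, Expr.eval, hk₂]
  have ri : ∀ i ≠ 2, s₃.reg i = s₂.reg i := fun i hi => by simp [hs₃, Prog.run, hi]
  have m2 : ∀ e, s₃.arr 2 e = if e = k then 1 else s₂.arr 2 e := fun e => by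
    simp [hs₃, Prog.run, Expr.eval, hk₂]
  have mi : ∀ b ≠ 2, s₃.arr b = s₂.arr b := fun b hb => by
    ext i; simp [hs₃, Prog.run, hb]
  have hR : ∀ u f, s₃.Recorded u f ↔ s₂.Recorded u f := fun u f => by
    unfold Store.Recorded
    rw [mi 3 (by omega), mi 4 (by omega), mi 5 (by omega), mi 6 (by omega)]
  refine ⟨⟨by omega, ?_, ?_, ?_, ?_, ?_⟩, by omega⟩
  · intro i hi
    rw [ri i hi, b1, a1, h.reg i hi]
  · intro e he
    rw [mi 0 (by omega), mi 1 (by omega), b2 0 e (by omega), b2 1 e (by omega),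
      a2 0 e (by omega), a2 1 e (by omega)]
    exact h.ends e he
  · intro e
    rw [m2, b2 2 e (by omega), a2 2 e (by omega), hmark, r2]
    split_ifs <;> omega
  · intro v
    rw [mi 6 (by omega), b3, a3, hdeg, r2, endDegree_range_succ]
  · intro e he
    rw [r2] at he
    rw [hR, hR]
    obtain rfl | he := Nat.lt_succ_iff_lt_or_eq.1 he |>.symm
    · exact ⟨b5 _ _ a6, b6⟩
    · exact ⟨b5 _ _ (a5 _ _ (hrec e he).1), b5 _ _ (a5 _ _ (hrec e he).2)⟩

theorem loopFree_recordBody : recordBody.LoopFree := by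
  simp [recordBody, addEnd, Prog.LoopFree]

theorem Records.halts_recordLoop {r : ℕ → ℕ} (h : Records x y m r s)
    (h3 : ∀ v, endDegree x y (range m) v ≤ 3) (hne : ∀ e < m, x e ≠ y e) (hr : r 1 = m) :
    Halts recordLoop s ((m + 1) * (3 + 1 + recordBody.maxCost)) fun s' =>
      Records x y m r s' ∧ s'.reg 2 = m := by
  have step : ∀ s, Records x y m r s → (Test.lt (.reg 2) (.reg 1)).Holds s →
      Records x y m r (recordBody.run s) ∧ m - (recordBody.run s).reg 2 < m - s.reg 2 := by
    intro s hs (hb : s.reg 2 < s.reg 1)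
    rw [hs.reg 1 (by omega), hr] at hb
    obtain ⟨h1, h2⟩ := hs.run_recordBody h3 hne hb
    exact ⟨h1, by omega⟩
  obtain ⟨t, s', ex, ht, hI, hb⟩ := exec_loop loopFree_recordBody (Records x y m r)
    (fun s => m - s.reg 2) step h
  refine ⟨t, s', ex, ht.trans (Nat.mul_le_mul_right _ (by omega)), hI, ?_⟩
  have hb' : ¬ s'.reg 2 < s'.reg 1 := hb
  rw [hI.reg 1 (by omega), hr] at hb'
  exact le_antisymm hI.le (not_lt.1 hb')

/-! ### Filling the stacks -/

/-- Push an edge and go to the next one. -/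
def pushBody : Prog := .seq (pushEdge (.reg 2)) (.setReg 2 (.succ (.reg 2)))

/-- Push all edges on the stacks. -/
def pushLoop : Prog := .loop (.lt (.reg 2) (.reg 1)) pushBody

theorem Represents.halts_pushLoop (h : Represents x y n m H s) (h1 : s.reg 1 = m)
    (h2 : s.reg 2 = 0) (hs : s.stackSize = 0) :
    Halts pushLoop s ((m + 1) * (3 + 1 + pushBody.maxCost)) fun s' =>
      Represents x y n m H s' ∧ (∀ e, s'.Stacked e) ∧ s'.stackSize ≤ 9 * m := by
  let I : Store → Prop := fun s => Represents x y n m H s ∧ s.reg 1 = m ∧ s.reg 2 ≤ m ∧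
    (∀ e < s.reg 2, s.Stacked e) ∧ s.stackSize ≤ 9 * s.reg 2
  have step : ∀ s, I s → (Test.lt (.reg 2) (.reg 1)).Holds s →
      I (pushBody.run s) ∧ m - (pushBody.run s).reg 2 < m - s.reg 2 := by
    rintro s ⟨hR, hr1, hr2, hst, hsz⟩ (hb : s.reg 2 < s.reg 1)
    obtain ⟨q1, q2⟩ := run_pushEdge (.reg 2) s
    have hrun : pushBody.run s = (Prog.setReg 2 (.succ (.reg 2))).run
      ((pushEdge (.reg 2)).run s) := rfl
    rw [hrun]
    generalize (pushEdge (.reg 2)).run s = s₁ at q1 q2 ⊢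
    have hq := q1.total
    have e1 := q1.reg 1 (by omega)
    have e2 := q1.reg 2 (by omega)
    have hR₁ := hR.extends q1
    simp only [Prog.run, Expr.eval] at q2 ⊢
    have hsize : (s₁.setReg 2 (s₁.reg 2 + 1)).stackSize = s₁.stackSize := by
      simp [Store.stackSize]
    have r2 : (s₁.setReg 2 (s₁.reg 2 + 1)).reg 2 = s.reg 2 + 1 := by simp [e2]
    have hstk : ∀ e, s₁.Stacked e → (s₁.setReg 2 (s₁.reg 2 + 1)).Stacked e := by
      intro e he τ hτ ht
      refine (he τ hτ ht).congr hτ (fun r hr => ?_) fun _ _ => rfl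
      rw [Store.reg_setReg, if_neg (by omega)]
    refine ⟨⟨⟨hR₁.subset, hR₁.ends, hR₁.mark, hR₁.degree, ?_, ?_, ?_, ?_, hR₁.incident⟩,
      ?_, ?_, ?_, ?_⟩, ?_⟩
    · simpa using hR₁.slack₀
    · simpa using hR₁.slack₁
    · simpa using hR₁.slack₂
    · simpa using hR₁.slack₃
    · simp [e1, hr1]
    · omega
    · intro e he
      rw [r2] at he
      obtain rfl | he := Nat.lt_succ_iff_lt_or_eq.1 he |>.symm
      · exact hstk _ q2
      · exact hstk _ (q1.stacked (hst e he))
    · omega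
    · omega
  obtain ⟨t, s', ex, ht, ⟨hR, hr1, hr2, hst, hsz⟩, hb⟩ := exec_loop (p := pushBody)
    ⟨loopFree_pushEdge _, trivial⟩ I (fun s => m - s.reg 2) step
    ⟨h, h1, by omega, fun e he => by omega, by omega⟩
  have hb' : ¬ s'.reg 2 < s'.reg 1 := hb
  refine ⟨t, s', ex, ht.trans (Nat.mul_le_mul_right _ (by omega)), hR, fun e => ?_, by omega⟩
  by_cases he : e < m
  · exact hst e (by omega)
  · intro τ _ ht
    exact absurd (mem_range.1 (hR.subset (hR.hasType_iff.1 ht).1)) he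

/-! ### The complete program and its running time -/

/-- A program that finds a State-0 spanning subgraph of a cubic multigraph. -/
def balancedSubgraph : Prog :=
  .seq initSlacks (.seq recordLoop (.seq (.setReg 2 (.lit 0)) (.seq pushLoop removalLoop)))

/-- With all degrees equal to 3 the counts for 0, 1, 2 vanish, so the slacks are the caps
themselves. Register 2 is reset to serve as the counter of `pushLoop`. -/
theorem Records.represents {r : ℕ → ℕ} (h : Records x y m r s) (h2 : s.reg 2 = m)
    (hreg : ∀ v < n, endDegree x y (range m) v = 3)
    (r3 : r 3 = (n + 2) / 4) (r4 : r 4 = n / 4 + 1) (r5 : r 5 = (n + 2) / 4 + 1) (r6 : r 6 = 2) :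
    Represents x y n m (range m) (s.setReg 2 0) := by
  have hz : ∀ k, k ≠ 3 → endDegreeCount x y (range n) (range m) k = 0 := by
    intro k hk
    rw [endDegreeCount, card_eq_zero, filter_eq_empty_iff]
    intro v hv hc
    exact hk (hc.symm.trans (hreg v (mem_range.1 hv)))
  have hmark := h.mark
  have hdeg := h.degree
  have hrec := h.recorded
  rw [h2] at hmark hdeg hrec
  refine ⟨subset_rfl, h.ends, ?_, hdeg, ?_, ?_, ?_, ?_, ?_⟩
  · intro e
    simp [hmark]
  · simp [h.reg 3 (by omega), r3, hz]
  · simp [h.reg 4 (by omega), r4, hz]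
  · simp [h.reg 5 (by omega), r5, hz]
  · simp [h.reg 6 (by omega), r6, hz]
  · intro e he v hv
    have : s.Recorded v e := by
      obtain rfl | rfl := hv
      · exact (hrec e he).1
      · exact (hrec e he).2
    obtain ⟨-, h'⟩ | ⟨-, h'⟩ | ⟨-, h'⟩ := this
    · exact .inl h'.symm
    · exact .inr (.inl h'.symm)
    · exact .inr (.inr h'.symm)

theorem halts_balancedSubgraph : ∃ c, ∀ (n m : ℕ) (x y : ℕ → ℕ), 3 * n = 2 * m →
    (∀ v < n, endDegree x y (range m) v = 3) → (∀ v, endDegree x y (range m) v ≤ 3) →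
    (∀ e < m, x e ≠ y e) → (∀ e < m, x e < n ∧ y e < n) →
    Halts balancedSubgraph (inputStore n m x y) (c * (n + 1)) fun s =>
      ∃ H : Finset ℕ, H ⊆ range m ∧ s.output = ↑H ∧ EdgesWithinBounds x y (range n) H ∧
        ∀ e ∈ H, ¬ EdgesWithinBounds x y (range n) (H.erase e) := by
  obtain ⟨c, hc⟩ := halts_initSlacks
  -- The factors 2 come from `m + 1 ≤ 2 * (n + 1)`, and `128 = 2 * (9 + 55)` from the initial
  -- potential, at most `9 * m + 55 * m`.
  refine ⟨c + 2 * (4 + recordBody.maxCost) + 2 + 2 * (4 + pushBody.maxCost) + 128 * removalCost,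
    fun n m x y hnm hreg h3 hne hn => ?_⟩
  have hrun := (hc n m x y).seq fun s₁ ⟨ha, hr1, hr2, hr10, hr3, hr4, hr5, hr6⟩ =>
    (show Records x y m s₁.reg s₁ from by
      refine ⟨by omega, fun _ _ => rfl, fun e he => ?_, fun e => ?_, fun v => ?_, fun e he => ?_⟩
      · rw [ha]; simp [inputStore, he]
      · rw [ha, hr2]; simp [inputStore]
      · rw [ha, hr2]; simp [inputStore, endDegree]
      · omega).halts_recordLoop h3 hne hr1 |>.seq fun s₂ ⟨hs₂, hm⟩ =>
    (Halts.of_loopFree (p := .setReg 2 (.lit 0)) trivial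
      (Q := fun s₃ => s₃ = s₂.setReg 2 0) rfl).seq fun s₃ hs₃ => by
        have hR := hs₂.represents hm hreg hr3 hr4 hr5 hr6
        rw [← hs₃] at hR
        refine Halts.seq (hR.halts_pushLoop ?_ ?_ ?_) (q := removalLoop)
          (T₂ := (9 * m + 55 * m + 1) * removalCost)
          (R := fun s => ∃ H : Finset ℕ, H ⊆ range m ∧ s.output = ↑H ∧
            EdgesWithinBounds x y (range n) H ∧
            ∀ e ∈ H, ¬ EdgesWithinBounds x y (range n) (H.erase e)) ?_
        · rw [hs₃]; simp [hs₂.reg 1, hr1]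
        · rw [hs₃]; simp
        · rw [hs₃]; simp [Store.stackSize, hs₂.reg, hr10]
        · rintro s₄ ⟨hR₄, hst, hsz⟩
          obtain ⟨t, s, ex, ht, H, hH, hdone⟩ := hR₄.halts_removalLoop hst hne hn h3
          rw [card_range] at ht
          refine ⟨t, s, ex, ht.trans (Nat.mul_le_mul_right _ (by omega)), H, hH.subset, ?_,
            hH.edgesWithinBounds, hdone⟩
          ext e
          simp [Store.output, hH.mark e]
  obtain ⟨t, s, ex, ht, hs⟩ := hrun
  refine ⟨t, s, ex, ht.trans ?_, hs⟩
  have hm : m + 1 ≤ 2 * (n + 1) := by omega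
  have e1 : (m + 1) * (3 + 1 + recordBody.maxCost) ≤
      2 * (4 + recordBody.maxCost) * (n + 1) :=
    (Nat.mul_le_mul_right _ hm).trans (le_of_eq (by ring))
  have e2 : (m + 1) * (3 + 1 + pushBody.maxCost) ≤ 2 * (4 + pushBody.maxCost) * (n + 1) :=
    (Nat.mul_le_mul_right _ hm).trans (le_of_eq (by ring))
  have e3 : (9 * m + 55 * m + 1) * removalCost ≤ 128 * removalCost * (n + 1) :=
    (Nat.mul_le_mul_right _ (show 9 * m + 55 * m + 1 ≤ 128 * (n + 1) by omega)).trans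
      (le_of_eq (by ring))
  have e4 : (Prog.setReg 2 (.lit 0)).maxCost = 2 := rfl
  rw [e4]
  simp only [Nat.add_mul] at e1 e2 e3 ⊢
  omega

end RAM

theorem theorem2 :
    (∀ {α β : Type*} (G : Graph α β), IsCubicMultigraph G →
      ∃ H : Graph α β, Graph.IsSpanningSubgraph H G ∧
        (∀ k : ℕ, k ≤ 3 → |(degreeCount H k : ℚ) - (V(G).ncard : ℚ) / 4| ≤ 2) ∧
        IsStateZero H) ∧
    (∃ (P : RAM.Prog) (c : ℕ),
      ∀ (n m : ℕ) (G : Graph ℕ ℕ) (x y : ℕ → ℕ),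
        IsCubicMultigraph G → V(G) = Set.Iio n → E(G) = Set.Iio m →
        (∀ e < m, G.IsLink e (x e) (y e)) →
        ∃ (t : ℕ) (s : RAM.Store), RAM.Exec P (RAM.inputStore n m x y) t s ∧
          t ≤ c * (n + 1) ∧
          Graph.IsSpanningSubgraph (G.restrict s.output) G ∧
          (∀ k : ℕ, k ≤ 3 →
            |(degreeCount (G.restrict s.output) k : ℚ) - (n : ℚ) / 4| ≤ 2) ∧
          IsStateZero (G.restrict s.output)) := by
  refine ⟨fun G hG => hG.exists_isStateZero, RAM.balancedSubgraph, ?_⟩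
  obtain ⟨c, hc⟩ := RAM.halts_balancedSubgraph
  refine ⟨c, fun n m G x y hG hV hE hl => ?_⟩
  rw [← Finset.coe_range] at hV hE
  have hl' : ∀ e ∈ Finset.range m, G.IsLink e (x e) (y e) := fun e he =>
    hl e (Finset.mem_range.1 he)
  have hloop := hG.loopless
  have hmem : ∀ e < m, x e < n ∧ y e < n := fun e he => by
    have := ends_mem hV hl' (Finset.mem_range.2 he)
    rwa [Finset.mem_range, Finset.mem_range] at this
  have hreg : ∀ v ∈ Finset.range n, endDegree x y (Finset.range m) v = 3 := fun v hv =>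
    endDegree_eq_three hG hV hE hl' hv
  -- The program lemma needs this bound for every natural number `v`; numbers that are not vertices
  -- have degree 0.
  have h3 : ∀ v, endDegree x y (Finset.range m) v ≤ 3 := by
    intro v
    by_cases hv : v ∈ Finset.range n
    · exact (hreg v hv).le
    · rw [Finset.mem_range] at hv
      rw [endDegree, Finset.card_eq_zero.2, Finset.card_eq_zero.2]
      · omega
      · refine Finset.filter_eq_empty_iff.2 fun e he hc => hv ?_
        exact hc ▸ (hmem e (Finset.mem_range.1 he)).2
      · refine Finset.filter_eq_empty_iff.2 fun e he hc => hv ?_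
        exact hc ▸ (hmem e (Finset.mem_range.1 he)).1
  have hnm := three_mul_card_of_regular (fun e he => ends_mem hV hl' he) hreg
  rw [Finset.card_range, Finset.card_range] at hnm
  obtain ⟨t, s, ex, ht, H, hH, hout, hw, hdone⟩ := hc n m x y hnm
    (fun v hv => hreg v (Finset.mem_range.2 hv)) h3 (fun e he => (hl e he).ne) hmem
  have hF : E(G) ∩ s.output = ↑H := by
    rw [hE, hout, Set.inter_eq_right]
    exact_mod_cast hH
  have hfin := isStateZero_of_no_removal hG hV hE hl' hF hw hdone
  rw [Finset.card_range] at hfin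
  exact ⟨t, s, ex, ht, hfin⟩
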